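/- Fix an integer $k\ge 1$ and a compact interval $I\subset\mathbb R$, and let $\mu,\tilde\mu$ be probability measures with supports contained in $I$. Assume that $\mu$ is absolutely continuous, that its support is an interval, and that $\mu$ has a density which is strictly positive on the interior of the support and differentiable on the support. For probability measures $\alpha,\beta$ on $\mathbb R$ let $\Pi(\alpha,\beta)$ be the set of their couplings, and put $W_1(\alpha,\beta)=\inf_{\pi\in\Pi(\alpha,\beta)}\int|x-y|\,d\pi$ and $W_\infty(\alpha,\beta)=\inf_{\pi\in\Pi(\alpha,\beta)}\sup_{(x,y)\in \mathrm{spt}(\pi)}|x-y|$. Let $\mathcal P_k(\mathbb R)$ be the set of probability measures $\sum_{j=1}^k w_j\delta_{x_j}$ with $w_j\ge 0$; a projection of $\zeta$ over $\mathcal P_k(\mathbb R)$ is a minimizer of $\lambda\mapsto W_1(\zeta,\lambda)$ over $\mathcal P_k(\mathbb R)$. Let $\nu^{(k)}$ be a projection of $\mu$. A percentile vector $\vec v_\zeta$ associated with $\zeta\in\{\mu,\tilde\mu\}$ is a vector with entries $(v_\zeta)_j=F_\zeta(y_j)$, where $F_\zeta$ is the c.d.f. of $\zeta$ and $y_1\le\dots\le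 y_k$ satisfy $\{y_1,\dots,y_k\}=\mathrm{spt}(\nu)$ for some projection $\nu$ of $\zeta$ over $\mathcal P_k(\mathbb R)$; let $\vec v_\mu$ and $\vec v_{\tilde\mu}$ be any such vectors for $\mu$ and $\tilde\mu$. For positions $\vec x\in\mathbb R^n$ and facilities $\vec y\in\mathbb R^k$ let $SC(\vec x,\vec y)=\frac1n\sum_{i=1}^n\min_{j}|x_i-y_j|$ and $SC_{opt}(\vec x)=\inf_{\vec y\in\mathbb R^k}SC(\vec x,\vec y)$. For a percentile vector $\vec v$, the percentile mechanism $\mathcal{PM}_{\vec v}$ places facility $j$ at the $(\lfloor (n-1)v_j\rfloor+1)$-th smallest entry of $\vec x$, and $SC_{\vec v}(\vec x)$ denotes its cost. Let $\vec X_n$ be a vector of $n$ i.i.d. random variables with law $\mu$, and put $B_{ar}^{(n)}(\mathcal{PM}_{\vec v})=\mathbb E[SC_{\vec v}(\vec X_n)]/\mathbb E[SC_{opt}(\vec X_n)]$. Then $W_1(\mu,\nu^{(k)})>0$, $\mathbb E[SC_{opt}(\vec X_n)]>0$ for every $n>k$, the limit below exists, and \[ \lim_{n\to\infty}\left|\frac{\mathbb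 E[SC_{\vec v_{\tilde\mu}}(\vec X_n)]}{\mathbb E[SC_{opt}(\vec X_n)]}-1\right|\le\frac{W_\infty(\mu,\tilde\mu)+2W_1(\mu,\tilde\mu)}{W_1(\mu,\nu^{(k)})}\le 3\,\frac{W_\infty(\mu,\tilde\mu)}{W_1(\mu,\nu^{(k)})}. \] Moreover, there exists a constant $C>0$ such that for every $n>k$ \[ \left|B_{ar}^{(n)}(\mathcal{PM}_{\vec v_\mu})-B_{ar}^{(n)}(\mathcal{PM}_{\vec v_{\tilde\mu}})\right|\le 3\,\frac{W_\infty(\mu,\tilde\mu)}{W_1(\mu,\nu^{(k)})}+\frac{C}{\sqrt n}. \] -/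

import Mathlib

open MeasureTheory ProbabilityTheory Filter Topology Set
open scoped ENNReal NNReal

namespace PercentileFLP

noncomputable section

/-- The set of transport plans between `α` and `β`: measures on `ℝ × ℝ` with first marginal `α`
and second marginal `β`. -/
def couplings (α β : Measure ℝ) : Set (Measure (ℝ × ℝ)) :=
  {π | π.map Prod.fst = α ∧ π.map Prod.snd = β}

/-- The Wasserstein distance of order one. -/
def W1 (α β : Measure ℝ) : ℝ≥0∞ :=
  ⨅ π ∈ couplings α β, ∫⁻ p, ENNReal.ofReal |p.1 - p.2| ∂π

/-- The Wasserstein distance of order infinity: the best possible value, over all transport plans,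
of the largest displacement on the support of the plan. -/
def WInf (α β : Measure ℝ) : ℝ≥0∞ :=
  ⨅ π ∈ couplings α β, ⨆ p ∈ π.support, ENNReal.ofReal |p.1 - p.2|

/-- Probability measures of the form `∑ j, w j • δ_{x j}` with `k` summands. -/
def atomicMeasures (k : ℕ) : Set (Measure ℝ) :=
  {ν | ∃ (x : Fin k → ℝ) (w : Fin k → ℝ≥0), ∑ j, w j = 1 ∧
    ν = ∑ j, (w j) • Measure.dirac (x j)}

/-- `ν` is a projection of `ζ` over the measures with at most `k` atoms, with respect to `W1`. -/
def IsProjection (k : ℕ) (ζ ν : Measure ℝ) : Prop :=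
  ν ∈ atomicMeasures k ∧ ∀ ρ ∈ atomicMeasures k, W1 ζ ν ≤ W1 ζ ρ

/-- `v` is the vector `v j = F_ζ (y j)`, where `y 0 ≤ y 1 ≤ …` lists the support of a projection of
`ζ` over the measures with at most `k` atoms and `F_ζ` is the c.d.f. of `ζ`. -/
def IsOptimalPercentileVector {k : ℕ} (ζ : Measure ℝ) (v : Fin k → ℝ) : Prop :=
  ∃ (ν : Measure ℝ) (y : Fin k → ℝ), IsProjection k ζ ν ∧ Monotone y ∧
    ν.support = range y ∧ ∀ j, v j = cdf ζ (y j)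

/-- The conditions on the distribution of the agents: it is absolutely continuous, its support is an
interval, and it has a density which is positive on the interior of the support and
differentiable on the support (one-sidedly at an end point). -/
def IsRegularDistribution (μ : Measure ℝ) : Prop :=
  μ.support.OrdConnected ∧ ∃ ρ : ℝ → ℝ, Measurable ρ ∧ (∀ x, 0 ≤ ρ x) ∧
    μ = volume.withDensity (fun x => ENNReal.ofReal (ρ x)) ∧
    (∀ x ∈ interior μ.support, 0 < ρ x) ∧ DifferentiableOn ℝ ρ μ.support

/-- The (rescaled) Social Cost of placing facilities at `y` when the agents are at `x`. -/
def socialCost {n k : ℕ} (x : Fin n → ℝ) (y : Fin k → ℝ) : ℝ :=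
  (1 / (n : ℝ)) * ∑ i, ⨅ j, |x i - y j|

/-- The optimal Social Cost with `k` facilities. -/
def optimalCost {n : ℕ} (k : ℕ) (x : Fin n → ℝ) : ℝ :=
  ⨅ y : Fin k → ℝ, socialCost x y

/-- For `n ≥ 1` agents and a percentile `p ∈ [0, 1]`, the index `⌊(n - 1) p⌋` (counting from `0`)
is a valid one. -/
theorem floor_lt_of_mem {n : ℕ} (hn : 0 < n) {p : ℝ} (hp : p ∈ Icc (0 : ℝ) 1) :
    ⌊((n : ℝ) - 1) * p⌋₊ < n := by
  have h1 : (1 : ℝ) ≤ n := by exact_mod_cast hn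
  rw [Nat.floor_lt (mul_nonneg (by linarith) hp.1)]
  nlinarith [hp.1, hp.2]

/-- The percentile mechanism: the `j`-th facility is placed at the `(⌊(n - 1) v j⌋ + 1)`-th smallest
report (that is, index `⌊(n - 1) v j⌋` counting from `0`). The value `0` is never used for
`n ≥ 1` and `v j ∈ [0, 1]`. -/
def percentileMechanism {n k : ℕ} (v : Fin k → ℝ) (x : Fin n → ℝ) : Fin k → ℝ := fun j =>
  if h : ⌊((n : ℝ) - 1) * v j⌋₊ < n then x (Tuple.sort x ⟨⌊((n : ℝ) - 1) * v j⌋₊, h⟩) else 0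

/-- Expected Social Cost of the percentile mechanism with `n` i.i.d. agents distributed as `μ`. -/
def expectedCost (μ : Measure ℝ) {k : ℕ} (v : Fin k → ℝ) (n : ℕ) : ℝ :=
  ∫ x : Fin n → ℝ, socialCost x (percentileMechanism v x) ∂(Measure.pi fun _ => μ)

/-- Expected optimal Social Cost with `n` i.i.d. agents distributed as `μ`. -/
def expectedOptimalCost (μ : Measure ℝ) (k n : ℕ) : ℝ :=
  ∫ x : Fin n → ℝ, optimalCost k x ∂(Measure.pi fun _ => μ)

/-- The Bayesian approximation ratio of the percentile mechanism with `n` agents. -/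
def bayesRatio (μ : Measure ℝ) {k : ℕ} (v : Fin k → ℝ) (n : ℕ) : ℝ :=
  expectedCost μ v n / expectedOptimalCost μ k n

end

end PercentileFLP

namespace PercentileFLP

/-- The distance from `x` to the nearest of the facilities `y`. -/
noncomputable def nearestDist {k : ℕ} (y : Fin k → ℝ) (x : ℝ) : ℝ := ⨅ j, |x - y j|

section NearestDist

variable {k : ℕ}

theorem nearestDist_le (y : Fin k → ℝ) (x : ℝ) (j : Fin k) : nearestDist y x ≤ |x - y j| :=
  ciInf_le (Set.finite_range _).bddBelow j

theorem nearestDist_nonneg (y : Fin k → ℝ) (x : ℝ) : 0 ≤ nearestDist y x :=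
  Real.iInf_nonneg fun _ => abs_nonneg _

theorem exists_nearestDist_eq (hk : 0 < k) (y : Fin k → ℝ) (x : ℝ) :
    ∃ j, nearestDist y x = |x - y j| := by
  have : Nonempty (Fin k) := ⟨⟨0, hk⟩⟩
  obtain ⟨j, hj⟩ := exists_eq_ciInf_of_finite (f := fun j => |x - y j|)
  exact ⟨j, hj.symm⟩

theorem nearestDist_le_add (hk : 0 < k) {y z : Fin k → ℝ} {x e : ℝ}
    (h : ∀ j, |x - y j| ≤ |x - z j| + e) : nearestDist y x ≤ nearestDist z x + e := by
  obtain ⟨j, hj⟩ := exists_nearestDist_eq hk z x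
  rw [hj]
  exact (nearestDist_le y x j).trans (h j)

theorem nearestDist_le_add_abs_sub (hk : 0 < k) (y : Fin k → ℝ) (x x' : ℝ) :
    nearestDist y x ≤ nearestDist y x' + |x - x'| := by
  obtain ⟨j, hj⟩ := exists_nearestDist_eq hk y x'
  rw [hj]
  refine (nearestDist_le y x j).trans ?_
  rw [add_comm]
  exact abs_sub_le x x' (y j)

theorem abs_nearestDist_sub_le (hk : 0 < k) (y : Fin k → ℝ) (x x' : ℝ) :
    |nearestDist y x - nearestDist y x'| ≤ |x - x'| := by
  rw [abs_le]
  have h1 := nearestDist_le_add_abs_sub hk y x x'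
  have h2 := nearestDist_le_add_abs_sub hk y x' x
  rw [abs_sub_comm x' x] at h2
  constructor <;> linarith

theorem continuous_nearestDist (hk : 0 < k) (y : Fin k → ℝ) : Continuous (nearestDist y) := by
  have : LipschitzWith 1 (nearestDist y) := LipschitzWith.of_dist_le_mul fun x x' => by
    simpa [Real.dist_eq] using abs_nearestDist_sub_le hk y x x'
  exact this.continuous

theorem socialCost_eq {n : ℕ} (x : Fin n → ℝ) (y : Fin k → ℝ) :
    socialCost x y = (1 / (n : ℝ)) * ∑ i, nearestDist y (x i) := rfl

theorem socialCost_nonneg {n : ℕ} (x : Fin n → ℝ) (y : Fin k → ℝ) : 0 ≤ socialCost x y :=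
  mul_nonneg (by positivity) (Finset.sum_nonneg fun i _ => nearestDist_nonneg y (x i))

end NearestDist

section Transport

variable {k : ℕ}

theorem lintegral_nearestDist_le_W1 {ζ ν : Measure ℝ} (hk : 0 < k) {y : Fin k → ℝ}
    (hν : ν (range y)ᶜ = 0) :
    ∫⁻ x, ENNReal.ofReal (nearestDist y x) ∂ζ ≤ W1 ζ ν := by
  refine le_iInf₂ fun π hπ => ?_
  have hm : Measurable fun x => ENNReal.ofReal (nearestDist y x) :=
    (continuous_nearestDist hk y).measurable.ennreal_ofReal
  rw [← hπ.1, lintegral_map hm measurable_fst]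
  refine lintegral_mono_ae ?_
  have h1 : ∀ᵐ p ∂π, p.2 ∈ range y := by
    have : ∀ᵐ z ∂(π.map Prod.snd), z ∈ range y := by rw [hπ.2]; exact hν
    exact ae_of_ae_map measurable_snd.aemeasurable this
  filter_upwards [h1] with p hp
  obtain ⟨j, hj⟩ := hp
  rw [← hj]
  exact ENNReal.ofReal_le_ofReal (nearestDist_le y p.1 j)

theorem exists_measurable_index (hk : 0 < k) (y : Fin k → ℝ) :
    ∃ f : ℝ → Fin k, Measurable f ∧ ∀ x, |x - y (f x)| = nearestDist y x := by
  obtain ⟨m, rfl⟩ : ∃ m, k = m + 1 := ⟨k - 1, by omega⟩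
  set e : ℕ → ℝ := fun i => y (Fin.ofNat (m + 1) i)
  have hle : ∀ x, SimpleFunc.nearestPtInd e m x ≤ m := SimpleFunc.nearestPtInd_le e m
  refine ⟨fun x => Fin.ofNat (m + 1) (SimpleFunc.nearestPtInd e m x),
    (measurable_from_top (f := fun i : ℕ => Fin.ofNat (m + 1) i)).comp
      (SimpleFunc.nearestPtInd e m).measurable, fun x => ?_⟩
  refine le_antisymm ?_ (nearestDist_le y x _)
  obtain ⟨j, hj⟩ := exists_nearestDist_eq hk y x
  rw [hj]
  have h := SimpleFunc.edist_nearestPt_le e x (k := (j : ℕ)) (N := m) (by omega)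
  rw [edist_dist, edist_dist, ENNReal.ofReal_le_ofReal_iff dist_nonneg, Real.dist_eq,
    Real.dist_eq, abs_sub_comm, abs_sub_comm (e j)] at h
  simpa [e, SimpleFunc.nearestPt] using h

theorem exists_atomicMeasure_W1_le (hk : 0 < k) (ζ : Measure ℝ) [IsProbabilityMeasure ζ]
    (y : Fin k → ℝ) :
    ∃ ρ ∈ atomicMeasures k, W1 ζ ρ ≤ ∫⁻ x, ENNReal.ofReal (nearestDist y x) ∂ζ := by
  obtain ⟨f, hf, hfy⟩ := exists_measurable_index hk y
  have hy : Measurable fun x => y (f x) := (measurable_of_finite y).comp hf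
  refine ⟨ζ.map (fun x => y (f x)), ⟨y, fun j => (ζ (f ⁻¹' {j})).toNNReal, ?_, ?_⟩, ?_⟩
  · have h : ∑ j, ζ (f ⁻¹' {j}) = 1 := by
      rw [← measure_biUnion_finset (fun i _ j _ hij => Disjoint.preimage f (by simpa using hij))
        (fun j _ => hf (measurableSet_singleton j))]
      rw [show (⋃ j ∈ Finset.univ, f ⁻¹' {j}) = univ by ext; simp, measure_univ]
    rw [← ENNReal.coe_inj]
    push_cast
    rw [← h]
    exact Finset.sum_congr rfl fun j _ => ENNReal.coe_toNNReal (measure_ne_top _ _)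
  · ext s hs
    rw [Measure.map_apply hy hs]
    simp only [Measure.coe_finsetSum, Finset.sum_apply, Measure.smul_apply,
      Measure.dirac_apply' _ hs]
    classical
    have : (fun x => y (f x)) ⁻¹' s = ⋃ j ∈ Finset.univ.filter (fun j => y j ∈ s), f ⁻¹' {j} := by
      ext x; simp
    rw [this, measure_biUnion_finset (fun i _ j _ hij => Disjoint.preimage f (by simpa using hij))
        (fun j _ => hf (measurableSet_singleton j)), Finset.sum_filter]
    refine Finset.sum_congr rfl fun j _ => ?_
    by_cases h : y j ∈ s
    · simp [h, ENNReal.smul_def]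
    · simp [h]
  · have hc : ζ.map (fun x => (x, y (f x))) ∈ couplings ζ (ζ.map fun x => y (f x)) := by
      constructor
      · rw [Measure.map_map measurable_fst (by fun_prop)]
        exact Measure.map_id
      · rw [Measure.map_map measurable_snd (by fun_prop)]
        rfl
    · refine (iInf₂_le _ hc).trans ?_
      rw [lintegral_map (by fun_prop) (by fun_prop)]
      simp [hfy]

theorem lintegral_le_lintegral_add_W1 {α β : Measure ℝ} {g : ℝ → ℝ} (hg : Measurable g)
    (h0 : ∀ x, 0 ≤ g x) (h : ∀ x x', g x ≤ g x' + |x - x'|) :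
    ∫⁻ x, ENNReal.ofReal (g x) ∂α ≤ ∫⁻ x, ENNReal.ofReal (g x) ∂β + W1 α β := by
  simp only [W1, ENNReal.add_iInf]
  refine le_iInf₂ fun π hπ => ?_
  rw [← hπ.1, ← hπ.2, lintegral_map hg.ennreal_ofReal measurable_fst,
    lintegral_map hg.ennreal_ofReal measurable_snd, ← lintegral_add_left (by fun_prop)]
  refine lintegral_mono fun p => ?_
  rw [← ENNReal.ofReal_add (h0 _) (abs_nonneg _)]
  exact ENNReal.ofReal_le_ofReal (h _ _)

theorem W1_comm (α β : Measure ℝ) : W1 α β = W1 β α := by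
  suffices H : ∀ α β : Measure ℝ, W1 α β ≤ W1 β α from le_antisymm (H _ _) (H _ _)
  intro α β
  refine le_iInf₂ fun π hπ => ?_
  have hc : π.map Prod.swap ∈ couplings α β := by
    constructor
    · rw [Measure.map_map measurable_fst measurable_swap]; exact hπ.2
    · rw [Measure.map_map measurable_snd measurable_swap]; exact hπ.1
  refine (iInf₂_le _ hc).trans ?_
  rw [lintegral_map (by fun_prop) measurable_swap]
  simp [abs_sub_comm]

theorem isProbabilityMeasure_of_mem_couplings {α β : Measure ℝ} [IsProbabilityMeasure α]
    {π : Measure (ℝ × ℝ)} (hπ : π ∈ couplings α β) : IsProbabilityMeasure π := by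
  constructor
  have := congrArg (fun m => m univ) hπ.1
  simpa [Measure.map_apply measurable_fst MeasurableSet.univ] using this

theorem W1_le_WInf (α β : Measure ℝ) [IsProbabilityMeasure α] : W1 α β ≤ WInf α β := by
  refine le_iInf₂ fun π hπ => (iInf₂_le π hπ).trans ?_
  have := isProbabilityMeasure_of_mem_couplings hπ
  calc ∫⁻ p, ENNReal.ofReal |p.1 - p.2| ∂π
      ≤ ∫⁻ _, (⨆ p ∈ π.support, ENNReal.ofReal |p.1 - p.2|) ∂π := by
        refine lintegral_mono_ae ?_
        filter_upwards [Measure.support_mem_ae (μ := π)] with p hp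
        exact le_iSup₂ (f := fun p (_ : p ∈ π.support) => ENNReal.ofReal |p.1 - p.2|) p hp
    _ = _ := by simp

theorem ae_mem_of_support_subset {α : Measure ℝ} {s : Set ℝ} (h : α.support ⊆ s) :
    ∀ᵐ x ∂α, x ∈ s :=
  mem_of_superset Measure.support_mem_ae h

theorem WInf_ne_top {α β : Measure ℝ} [IsProbabilityMeasure α] [IsProbabilityMeasure β] {a b : ℝ}
    (hα : α.support ⊆ Icc a b) (hβ : β.support ⊆ Icc a b) : WInf α β ≠ ⊤ := by
  have hc : α.prod β ∈ couplings α β := ⟨by simp, by simp⟩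
  refine ne_top_of_le_ne_top (ENNReal.ofReal_ne_top (r := b - a)) ((iInf₂_le _ hc).trans ?_)
  refine iSup₂_le fun p hp => ENNReal.ofReal_le_ofReal ?_
  have : p ∈ Icc a b ×ˢ Icc a b := by
    refine Measure.support_subset_of_isClosed (isClosed_Icc.prod isClosed_Icc) ?_ hp
    filter_upwards [Measure.quasiMeasurePreserving_fst.ae (ae_mem_of_support_subset hα),
      Measure.quasiMeasurePreserving_snd.ae (ae_mem_of_support_subset hβ)] with p h1 h2
    exact ⟨h1, h2⟩
  exact abs_le.2 ⟨by linarith [this.1.1, this.2.2], by linarith [this.1.2, this.2.1]⟩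

theorem measure_Iic_le_of_coupling {α β : Measure ℝ} {π : Measure (ℝ × ℝ)}
    (hπ : π ∈ couplings α β) {w : ℝ} (h : ∀ᵐ p ∂π, |p.1 - p.2| ≤ w) (t : ℝ) :
    β (Iic t) ≤ α (Iic (t + w)) ∧ α (Iic t) ≤ β (Iic (t + w)) := by
  rw [← hπ.1, ← hπ.2]
  simp only [Measure.map_apply measurable_fst measurableSet_Iic,
    Measure.map_apply measurable_snd measurableSet_Iic]
  constructor <;> refine measure_mono_ae ?_ <;> filter_upwards [h] with p hp hpt
  · have h1 : p.2 ≤ t := hpt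
    exact show p.1 ≤ t + w by linarith [(abs_le.1 hp).2]
  · have h1 : p.1 ≤ t := hpt
    exact show p.2 ≤ t + w by linarith [(abs_le.1 hp).1]

theorem cdf_le_cdf_add_of_WInf_lt {α β : Measure ℝ} [IsProbabilityMeasure α]
    [IsProbabilityMeasure β] {w : ℝ} (h : WInf α β < ENNReal.ofReal w) (t : ℝ) :
    cdf β t ≤ cdf α (t + w) ∧ cdf α t ≤ cdf β (t + w) := by
  simp only [WInf, iInf_lt_iff] at h
  obtain ⟨π, hπ, hlt⟩ := h
  have hw : 0 ≤ w := by
    by_contra hw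
    simp [ENNReal.ofReal_of_nonpos (le_of_not_ge hw)] at hlt
  have hae : ∀ᵐ p ∂π, |p.1 - p.2| ≤ w := by
    filter_upwards [Measure.support_mem_ae (μ := π)] with p hp
    rw [← ENNReal.ofReal_le_ofReal_iff hw]
    exact (le_iSup₂ (f := fun p (_ : p ∈ π.support) => ENNReal.ofReal |p.1 - p.2|) p hp).trans
      hlt.le
  have := measure_Iic_le_of_coupling hπ hae t
  simp only [cdf_eq_real, measureReal_def]
  exact ⟨ENNReal.toReal_mono (measure_ne_top _ _) this.1,
    ENNReal.toReal_mono (measure_ne_top _ _) this.2⟩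

theorem WInf_self (α : Measure ℝ) : WInf α α = 0 := by
  have hd : Measurable fun x : ℝ => (x, x) := by fun_prop
  have hc : α.map (fun x => (x, x)) ∈ couplings α α := by
    constructor
    · rw [Measure.map_map measurable_fst hd]; exact Measure.map_id
    · rw [Measure.map_map measurable_snd hd]; exact Measure.map_id
  refine le_antisymm ((iInf₂_le _ hc).trans (iSup₂_le fun p hp => ?_)) (zero_le)
  have hcl : IsClosed {p : ℝ × ℝ | p.1 = p.2} := isClosed_eq continuous_fst continuous_snd
  have : p ∈ {p : ℝ × ℝ | p.1 = p.2} := by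
    refine Measure.support_subset_of_isClosed hcl ?_ hp
    exact (ae_map_iff hd.aemeasurable hcl.measurableSet).2 (by simp)
  have h : p.1 = p.2 := this
  simp [h]

theorem W1_ne_top_of_isProjection {ζ ν : Measure ℝ} [IsProbabilityMeasure ζ] {a b : ℝ}
    (hζ : ζ.support ⊆ Icc a b) (hk : 0 < k) (h : IsProjection k ζ ν) : W1 ζ ν ≠ ⊤ := by
  obtain ⟨ρ, hρ, hle⟩ := exists_atomicMeasure_W1_le hk ζ (fun _ => a)
  refine ne_top_of_le_ne_top (ENNReal.ofReal_ne_top (r := b - a)) ((h.2 ρ hρ).trans (hle.trans ?_))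
  calc _ ≤ ∫⁻ _, ENNReal.ofReal (b - a) ∂ζ := by
        refine lintegral_mono_ae ?_
        filter_upwards [ae_mem_of_support_subset hζ] with x hx
        refine ENNReal.ofReal_le_ofReal ((nearestDist_le _ x ⟨0, hk⟩).trans ?_)
        exact abs_le.2 ⟨by linarith [hx.1, hx.2], by linarith [hx.1, hx.2]⟩
    _ = _ := by simp

theorem map_mem_atomicMeasures {ν : Measure ℝ} (h : ν ∈ atomicMeasures k) {f : ℝ → ℝ}
    (hf : Measurable f) : ν.map f ∈ atomicMeasures k := by
  obtain ⟨x, w, hw, rfl⟩ := h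
  refine ⟨fun j => f (x j), w, hw, ?_⟩
  ext s hs
  rw [Measure.map_apply hf hs]
  simp only [Measure.coe_finsetSum, Finset.sum_apply, Measure.smul_apply,
      Measure.dirac_apply' _ hs, Measure.dirac_apply' _ (hf hs)]
  rfl

/-- Moving the target points by a map that brings every point of a set `s` closer, by at least `ε`,
to almost every source point, without moving the others away, cannot happen when `ν` is a
projection that charges `s`. -/
theorem not_improvable_of_isProjection {ζ ν : Measure ℝ} (h : IsProjection k ζ ν)
    (hfin : W1 ζ ν ≠ ⊤) {f : ℝ → ℝ} (hf : Measurable f) {s : Set ℝ} (hs : MeasurableSet s)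
    (hνs : ν s ≠ 0) {ε : ℝ} (hε : 0 < ε)
    (himp : ∀ᵐ x ∂ζ, ∀ z, |x - f z| ≤ |x - z| ∧ (z ∈ s → |x - f z| + ε ≤ |x - z|)) : False := by
  have key : W1 ζ (ν.map f) + ENNReal.ofReal ε * ν s ≤ W1 ζ ν := by
    refine le_iInf₂ fun π hπ => ?_
    have hm : Measurable fun p : ℝ × ℝ => (p.1, f p.2) := by fun_prop
    have hc : π.map (fun p => (p.1, f p.2)) ∈ couplings ζ (ν.map f) := by
      constructor
      · rw [Measure.map_map measurable_fst hm]; exact hπ.1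
      · rw [Measure.map_map measurable_snd hm, ← hπ.2, Measure.map_map hf measurable_snd]; rfl
    have h1 : W1 ζ (ν.map f) ≤ ∫⁻ p, ENNReal.ofReal |p.1 - f p.2| ∂π := by
      refine (iInf₂_le _ hc).trans ?_
      rw [lintegral_map (by fun_prop) hm]
    have h2 : ENNReal.ofReal ε * ν s
        = ∫⁻ p, (Prod.snd ⁻¹' s).indicator (fun _ => ENNReal.ofReal ε) p ∂π := by
      rw [lintegral_indicator_const (measurable_snd hs), ← hπ.2,
        Measure.map_apply measurable_snd hs]
    rw [h2]
    refine (add_le_add_left h1 _).trans ?_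
    rw [← lintegral_add_left (by fun_prop)]
    refine lintegral_mono_ae ?_
    have h3 := ae_of_ae_map (μ := π) measurable_fst.aemeasurable (hπ.1 ▸ himp)
    filter_upwards [h3] with p hp
    by_cases hps : p.2 ∈ s
    · rw [indicator_of_mem (by exact hps), ← ENNReal.ofReal_add (abs_nonneg _) hε.le]
      exact ENNReal.ofReal_le_ofReal ((hp p.2).2 hps)
    · rw [indicator_of_notMem (by exact hps), add_zero]
      exact ENNReal.ofReal_le_ofReal (hp p.2).1
  have hle := h.2 _ (map_mem_atomicMeasures h.1 hf)
  have hpos : 0 < ENNReal.ofReal ε * ν s :=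
    ENNReal.mul_pos (ENNReal.ofReal_pos.2 hε).ne' hνs
  have hfin' : W1 ζ (ν.map f) ≠ ⊤ := ne_top_of_le_ne_top hfin (le_self_add.trans key)
  have := ENNReal.lt_add_right hfin' hpos.ne'
  exact absurd (this.trans_le key) (not_lt.2 hle)

theorem cdf_pos_of_mem_support_projection {ζ ν : Measure ℝ} [IsProbabilityMeasure ζ]
    (h : IsProjection k ζ ν) (hfin : W1 ζ ν ≠ ⊤) {y ε : ℝ} (hy : y ∈ ν.support) (hε : 0 < ε) :
    0 < cdf ζ (y + ε) := by
  by_contra hcon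
  have h0 : cdf ζ (y + ε) = 0 := le_antisymm (not_lt.1 hcon) (cdf_nonneg ζ _)
  rw [cdf_eq_real, measureReal_eq_zero_iff] at h0
  refine not_improvable_of_isProjection h hfin (f := fun z => max z (y + ε)) (by fun_prop)
    (measurableSet_Iio (a := y + ε / 2)) ?_ (half_pos hε) ?_
  · exact ((Measure.mem_support_iff_forall y).1 hy _ (Iio_mem_nhds (by linarith))).ne'
  · have : ∀ᵐ x ∂ζ, x ∉ Iic (y + ε) := measure_eq_zero_iff_ae_notMem.1 h0
    filter_upwards [this] with x hx z
    simp only [mem_Iic, not_le] at hx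
    simp only [mem_Iio]
    rcases le_total z (y + ε) with hz | hz
    · rw [max_eq_right hz, abs_of_nonneg (by linarith), abs_of_nonneg (by linarith)]
      exact ⟨by linarith, fun _ => by linarith⟩
    · rw [max_eq_left hz]
      exact ⟨le_rfl, fun _ => by linarith⟩

theorem cdf_lt_one_of_mem_support_projection {ζ ν : Measure ℝ} [IsProbabilityMeasure ζ]
    (h : IsProjection k ζ ν) (hfin : W1 ζ ν ≠ ⊤) {y ε : ℝ} (hy : y ∈ ν.support) (hε : 0 < ε) :
    cdf ζ (y - ε) < 1 := by
  by_contra hcon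
  have h1 : cdf ζ (y - ε) = 1 := le_antisymm (cdf_le_one ζ _) (not_lt.1 hcon)
  have h0 : ζ (Iic (y - ε))ᶜ = 0 := by
    rw [prob_compl_eq_zero_iff measurableSet_Iic]
    rw [cdf_eq_real, measureReal_def] at h1
    exact (ENNReal.toReal_eq_one_iff _).1 h1
  refine not_improvable_of_isProjection h hfin (f := fun z => min z (y - ε)) (by fun_prop)
    (measurableSet_Ioi (a := y - ε / 2)) ?_ (half_pos hε) ?_
  · exact ((Measure.mem_support_iff_forall y).1 hy _ (Ioi_mem_nhds (by linarith))).ne'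
  · have : ∀ᵐ x ∂ζ, x ∈ Iic (y - ε) := h0
    filter_upwards [this] with x hx z
    simp only [mem_Iic] at hx
    simp only [mem_Ioi]
    rcases le_total z (y - ε) with hz | hz
    · rw [min_eq_left hz]
      exact ⟨le_rfl, fun _ => by linarith⟩
    · rw [min_eq_right hz, abs_of_nonpos (by linarith), abs_of_nonpos (by linarith)]
      exact ⟨by linarith, fun _ => by linarith⟩

end Transport

section Quantile

theorem measure_Ioc_eq_cdf_sub (μ : Measure ℝ) [IsProbabilityMeasure μ] (s t : ℝ) :
    μ (Ioc s t) = ENNReal.ofReal (cdf μ t - cdf μ s) := by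
  conv_lhs => rw [← measure_cdf μ]
  exact StieltjesFunction.measure_Ioc _ _ _

theorem continuous_cdf (μ : Measure ℝ) [IsProbabilityMeasure μ] [NullSingletonClass μ] :
    Continuous (cdf μ) := by
  refine continuous_iff_continuousAt.2 fun x => ?_
  rw [(monotone_cdf μ).continuousAt_iff_leftLim_eq_rightLim, StieltjesFunction.rightLim_eq]
  have h : (cdf μ).measure {x} = 0 := by rw [measure_cdf]; exact measure_singleton x
  rw [StieltjesFunction.measure_singleton, ENNReal.ofReal_eq_zero] at h
  exact le_antisymm ((monotone_cdf μ).leftLim_le le_rfl) (by linarith)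

theorem IsRegularDistribution.nullSingletonClass {μ : Measure ℝ} (h : IsRegularDistribution μ) :
    NullSingletonClass μ := by
  obtain ⟨-, ρ, -, -, hμ, -⟩ := h
  constructor
  intro x
  rw [hμ]
  exact withDensity_absolutelyContinuous _ _ (measure_singleton x)

theorem cdf_of_lt {μ : Measure ℝ} [IsProbabilityMeasure μ] {a b t : ℝ}
    (h : μ.support ⊆ Icc a b) (ht : t < a) : cdf μ t = 0 := by
  rw [cdf_eq_real, measureReal_eq_zero_iff]
  refine measure_mono_null (fun x hx => ?_) (ae_mem_of_support_subset h)
  exact fun hx' => absurd (hx'.1.trans hx) (not_le.2 ht)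

theorem cdf_of_ge {μ : Measure ℝ} [IsProbabilityMeasure μ] {a b t : ℝ}
    (h : μ.support ⊆ Icc a b) (ht : b ≤ t) : cdf μ t = 1 := by
  rw [cdf_eq_real, measureReal_def, ENNReal.toReal_eq_one_iff, ← prob_compl_eq_zero_iff
    measurableSet_Iic]
  refine measure_mono_null (fun x hx => ?_) (ae_mem_of_support_subset h)
  exact fun hx' => hx (hx'.2.trans ht)

theorem cdf_left {μ : Measure ℝ} [IsProbabilityMeasure μ] [NullSingletonClass μ] {a b : ℝ}
    (h : μ.support ⊆ Icc a b) : cdf μ a = 0 := by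
  rw [cdf_eq_real, measureReal_eq_zero_iff, ← measure_congr Iio_ae_eq_Iic]
  refine measure_mono_null (fun x hx => ?_) (ae_mem_of_support_subset h)
  exact fun hx' => absurd hx'.1 (not_le.2 hx)

/-- `q` is a point at which the c.d.f. takes the value `v`, and the c.d.f. differs from `v` at every
other point, up to the regions without mass on the left and on the right. -/
structure IsQuantile (μ : Measure ℝ) (v q : ℝ) : Prop where
  cdf_eq : cdf μ q = v
  of_lt : ∀ t < q, cdf μ t < v ∨ cdf μ t = 0
  of_gt : ∀ t, q < t → v < cdf μ t ∨ cdf μ t = 1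

theorem nonempty_support_inter_of_cdf_lt {μ : Measure ℝ} [IsProbabilityMeasure μ] [NullSingletonClass μ]
    {s t : ℝ} (h : cdf μ s < cdf μ t) : ∃ x ∈ μ.support, s < x ∧ x < t := by
  have h1 : 0 < μ (Ioo s t) := by
    rw [measure_congr Ioo_ae_eq_Ioc, measure_Ioc_eq_cdf_sub]
    exact ENNReal.ofReal_pos.2 (by linarith)
  obtain ⟨x, hx, hx'⟩ := Measure.nonempty_inter_support_of_pos h1
  exact ⟨x, hx', hx.1, hx.2⟩

theorem cdf_lt_cdf_of_lt {μ : Measure ℝ} [IsProbabilityMeasure μ] [NullSingletonClass μ]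
    (hc : μ.support.OrdConnected) {s t : ℝ} (hst : s < t) (hs : cdf μ s ≠ 0) (ht : cdf μ t ≠ 1) :
    cdf μ s < cdf μ t := by
  refine lt_of_le_of_ne (monotone_cdf μ hst.le) fun heq => ?_
  have h0 : 0 < cdf μ s := lt_of_le_of_ne (cdf_nonneg _ _) hs.symm
  have h1 : cdf μ t < 1 := lt_of_le_of_ne (cdf_le_one _ _) ht
  have hbot : ∃ r, cdf μ r < cdf μ s := ((tendsto_cdf_atBot μ).eventually_lt_const h0).exists
  have htop : ∃ r, cdf μ t < cdf μ r := ((tendsto_cdf_atTop μ).eventually_const_lt h1).exists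
  obtain ⟨r, hr⟩ := hbot
  obtain ⟨r', hr'⟩ := htop
  obtain ⟨x, hx, -, hxs⟩ := nonempty_support_inter_of_cdf_lt hr
  obtain ⟨x', hx', htx, -⟩ := nonempty_support_inter_of_cdf_lt hr'
  have hmid : (s + t) / 2 ∈ μ.support := hc.out hx hx' ⟨by linarith, by linarith⟩
  have hpos := (Measure.mem_support_iff_forall _).1 hmid (Ioc s t)
    (Ioc_mem_nhds (by linarith) (by linarith))
  rw [measure_Ioc_eq_cdf_sub, heq] at hpos
  simp at hpos

theorem exists_isQuantile {μ : Measure ℝ} [IsProbabilityMeasure μ] [NullSingletonClass μ]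
    (hc : μ.support.OrdConnected) {a b : ℝ} (hI : μ.support ⊆ Icc a b) {v : ℝ}
    (hv : v ∈ Icc (0 : ℝ) 1) : ∃ q ∈ Icc a b, IsQuantile μ v q := by
  have hF := continuous_cdf μ
  have hFa : cdf μ a = 0 := cdf_left hI
  have hFb : cdf μ b = 1 := cdf_of_ge hI le_rfl
  have hab : a ≤ b := by
    by_contra hba
    have := monotone_cdf μ (not_le.1 hba).le
    linarith
  rcases hv.1.eq_or_lt with rfl | hv0
  · have hK : IsCompact (Icc a b ∩ cdf μ ⁻¹' {0}) :=
      isCompact_Icc.inter_right (isClosed_singleton.preimage hF)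
    obtain ⟨q, ⟨hqI, hq⟩, hmax⟩ := hK.exists_isGreatest ⟨a, ⟨le_rfl, hab⟩, hFa⟩
    have hq : cdf μ q = 0 := hq
    refine ⟨q, hqI, hq, fun t ht => Or.inr ?_, fun t ht => ?_⟩
    · exact le_antisymm (hq ▸ monotone_cdf μ ht.le) (cdf_nonneg _ _)
    · rcases le_total b t with hbt | htb
      · exact Or.inr (cdf_of_ge hI hbt)
      · refine Or.inl (lt_of_le_of_ne (cdf_nonneg _ _) fun h => ?_)
        exact absurd (hmax ⟨⟨hqI.1.trans ht.le, htb⟩, h.symm⟩) (not_le.2 ht)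
  rcases hv.2.eq_or_lt with rfl | hv1
  · have hK : IsCompact (Icc a b ∩ cdf μ ⁻¹' {1}) :=
      isCompact_Icc.inter_right (isClosed_singleton.preimage hF)
    obtain ⟨q, ⟨hqI, hq⟩, hmin⟩ := hK.exists_isLeast ⟨b, ⟨hab, le_rfl⟩, hFb⟩
    have hq : cdf μ q = 1 := hq
    refine ⟨q, hqI, hq, fun t ht => ?_, fun t ht => Or.inr ?_⟩
    · rcases lt_or_ge t a with hta | hat
      · exact Or.inr (cdf_of_lt hI hta)
      · refine Or.inl (lt_of_le_of_ne (cdf_le_one _ _) fun h => ?_)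
        exact absurd (hmin ⟨⟨hat, ht.le.trans hqI.2⟩, h⟩) (not_le.2 ht)
    · exact le_antisymm (cdf_le_one _ _) (hq ▸ monotone_cdf μ ht.le)
  obtain ⟨q, hqI, hq⟩ := intermediate_value_Icc hab hF.continuousOn
    (show v ∈ Icc (cdf μ a) (cdf μ b) from ⟨by linarith, by linarith⟩)
  refine ⟨q, hqI, hq, fun t ht => ?_, fun t ht => ?_⟩
  · by_cases h : cdf μ t = 0
    · exact Or.inr h
    · exact Or.inl (hq ▸ cdf_lt_cdf_of_lt hc ht h (by linarith))
  · by_cases h : cdf μ t = 1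
    · exact Or.inr h
    · exact Or.inl (hq ▸ cdf_lt_cdf_of_lt hc ht (by linarith) h)

theorem IsQuantile.abs_sub_le_WInf {μ μt : Measure ℝ} [IsProbabilityMeasure μ]
    [IsProbabilityMeasure μt] {y q : ℝ} (hq : IsQuantile μ (cdf μt y) q) (hfin : WInf μ μt ≠ ⊤)
    (hpos : ∀ ε > 0, 0 < cdf μt (y + ε)) (hlt : ∀ ε > 0, cdf μt (y - ε) < 1) :
    |q - y| ≤ (WInf μ μt).toReal := by
  refine le_of_forall_gt_imp_ge_of_dense fun w hw => ?_
  have hw' : WInf μ μt < ENNReal.ofReal w := (ENNReal.lt_ofReal_iff_toReal_lt hfin).2 hw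
  rw [abs_le]
  constructor
  · by_contra! hcon
    obtain ⟨ε, hε, hεq⟩ : ∃ ε > 0, q < y - ε - w := ⟨(y - w - q) / 2, by linarith, by linarith⟩
    have h1 := (cdf_le_cdf_add_of_WInf_lt hw' (y - ε - w)).2
    rw [sub_add_cancel] at h1
    have h2 := monotone_cdf μt (show y - ε ≤ y by linarith)
    rcases hq.of_gt _ hεq with h | h
    · linarith
    · linarith [hlt ε hε]
  · by_contra! hcon
    obtain ⟨ε, hε, hεq⟩ : ∃ ε > 0, y + ε + w < q := ⟨(q - y - w) / 2, by linarith, by linarith⟩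
    have h1 := (cdf_le_cdf_add_of_WInf_lt hw' (y + ε)).1
    have h2 := monotone_cdf μt (show y ≤ y + ε by linarith)
    rcases hq.of_lt _ hεq with h | h
    · linarith
    · linarith [hpos ε hε]

theorem IsRegularDistribution.exists_linear_growth {μ : Measure ℝ} [IsProbabilityMeasure μ]
    (h : IsRegularDistribution μ) {q : ℝ} (h0 : 0 < cdf μ q) (h1 : cdf μ q < 1) {R : ℝ}
    (hR : 0 ≤ R) :
    ∃ c > 0, ∀ t, |t - q| ≤ R → c * |t - q| ≤ |cdf μ t - cdf μ q| := by
  have := h.nullSingletonClass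
  obtain ⟨hc, ρ, hρm, -, hμ, hρpos, hρd⟩ := h
  obtain ⟨r, hr⟩ := ((tendsto_cdf_atBot μ).eventually_lt_const h0).exists
  obtain ⟨r', hr'⟩ := ((tendsto_cdf_atTop μ).eventually_const_lt h1).exists
  obtain ⟨x, hx, -, hxq⟩ := nonempty_support_inter_of_cdf_lt hr
  obtain ⟨x', hx', hqx, -⟩ := nonempty_support_inter_of_cdf_lt hr'
  have hnhds : μ.support ∈ 𝓝 q := mem_of_superset (Icc_mem_nhds hxq hqx) (hc.out hx hx')
  have hq : 0 < ρ q := hρpos q (mem_interior_iff_mem_nhds.2 hnhds)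
  have hcont : ContinuousAt ρ q := (hρd.differentiableAt hnhds).continuousAt
  obtain ⟨δ, hδ, hball⟩ := Metric.eventually_nhds_iff.1
    (hcont.eventually_const_lt (show ρ q / 2 < ρ q by linarith))
  have hinc : ∀ s t, s ≤ t → q - δ < s → t < q + δ → ρ q / 2 * (t - s) ≤ cdf μ t - cdf μ s := by
    intro s t hst hs ht
    have hle : ENNReal.ofReal (ρ q / 2 * (t - s)) ≤ ENNReal.ofReal (cdf μ t - cdf μ s) := by
      rw [← measure_Ioc_eq_cdf_sub, hμ, withDensity_apply _ measurableSet_Ioc,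
        ENNReal.ofReal_mul (by positivity), ← Real.volume_Ioc, ← setLIntegral_const]
      refine setLIntegral_mono_ae (by fun_prop) (ae_of_all _ fun z hz => ?_)
      refine ENNReal.ofReal_le_ofReal (hball ?_).le
      rw [Real.dist_eq, abs_lt]
      exact ⟨by linarith [hz.1], by linarith [hz.2]⟩
    exact (ENNReal.ofReal_le_ofReal_iff (by linarith [monotone_cdf μ hst])).1 hle
  set m := ρ q / 2
  have hm : 0 < m := by positivity
  have hbase : ∀ t, |t - q| ≤ δ / 2 → m * |t - q| ≤ |cdf μ t - cdf μ q| := by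
    intro t ht
    rcases le_total q t with hqt | htq
    · rw [abs_of_nonneg (by linarith)] at ht ⊢
      exact (hinc q t hqt (by linarith) (by linarith)).trans (le_abs_self _)
    · rw [abs_of_nonpos (by linarith)] at ht ⊢
      rw [abs_sub_comm]
      refine le_trans ?_ ((hinc t q htq (by linarith) (by linarith)).trans (le_abs_self _))
      linarith
  refine ⟨m * (δ / 2) / (R + δ / 2), by positivity, fun t ht => ?_⟩
  rw [div_mul_eq_mul_div, div_le_iff₀ (by positivity)]
  rcases le_total |t - q| (δ / 2) with hs | hs
  · have h2 := hbase t hs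
    have h3 : 0 ≤ m * |t - q| := by positivity
    nlinarith
  · have h2 : m * (δ / 2) ≤ |cdf μ t - cdf μ q| := by
      rcases le_total q t with hqt | htq
      · rw [abs_of_nonneg (by linarith)] at hs
        have h3 := hinc q (q + δ / 2) (by linarith) (by linarith) (by linarith)
        have h4 := monotone_cdf μ (show q + δ / 2 ≤ t by linarith)
        exact le_trans (by linarith) (le_abs_self _)
      · rw [abs_of_nonpos (by linarith)] at hs
        have h3 := hinc (q - δ / 2) q (by linarith) (by linarith) (by linarith)
        have h4 := monotone_cdf μ (show t ≤ q - δ / 2 by linarith)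
        rw [abs_sub_comm]
        exact le_trans (by linarith) (le_abs_self _)
    have h5 : 0 < m * (δ / 2) := by positivity
    nlinarith

end Quantile

section Comparison

variable {k : ℕ}

theorem integrable_nearestDist (hk : 0 < k) {μ : Measure ℝ} [IsProbabilityMeasure μ] {a b : ℝ}
    (hI : μ.support ⊆ Icc a b) (y : Fin k → ℝ) : Integrable (nearestDist y) μ := by
  refine Integrable.of_bound (continuous_nearestDist hk y).aestronglyMeasurable
    (nearestDist y a + (b - a)) ?_
  filter_upwards [ae_mem_of_support_subset hI] with x hx
  rw [Real.norm_eq_abs, abs_of_nonneg (nearestDist_nonneg y x)]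
  refine (nearestDist_le_add_abs_sub hk y x a).trans ?_
  rw [abs_of_nonneg (by linarith [hx.1])]
  linarith [hx.2]

theorem lintegral_nearestDist_eq (hk : 0 < k) {μ : Measure ℝ} [IsProbabilityMeasure μ] {a b : ℝ}
    (hI : μ.support ⊆ Icc a b) (y : Fin k → ℝ) :
    ∫⁻ x, ENNReal.ofReal (nearestDist y x) ∂μ = ENNReal.ofReal (∫ x, nearestDist y x ∂μ) :=
  (ofReal_integral_eq_lintegral_ofReal (integrable_nearestDist hk hI y)
    (ae_of_all _ (nearestDist_nonneg y))).symm

theorem W1_toReal_le_integral_nearestDist (hk : 0 < k) {μ ν : Measure ℝ} [IsProbabilityMeasure μ]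
    {a b : ℝ} (hI : μ.support ⊆ Icc a b) (hν : IsProjection k μ ν) (y : Fin k → ℝ) :
    (W1 μ ν).toReal ≤ ∫ x, nearestDist y x ∂μ := by
  obtain ⟨ρ, hρ, hle⟩ := exists_atomicMeasure_W1_le hk μ y
  rw [lintegral_nearestDist_eq hk hI] at hle
  exact ENNReal.toReal_le_of_le_ofReal (integral_nonneg (nearestDist_nonneg y))
    ((hν.2 ρ hρ).trans hle)

theorem integral_nearestDist_le_of_concentrated (hk : 0 < k) {μ ν : Measure ℝ}
    [IsProbabilityMeasure μ] {a b : ℝ} (hI : μ.support ⊆ Icc a b) (hfin : W1 μ ν ≠ ⊤)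
    {y : Fin k → ℝ} (hy : ν (range y)ᶜ = 0) :
    ∫ x, nearestDist y x ∂μ ≤ (W1 μ ν).toReal := by
  have h := lintegral_nearestDist_le_W1 (ζ := μ) hk hy
  rw [lintegral_nearestDist_eq hk hI] at h
  exact (ENNReal.ofReal_le_iff_le_toReal hfin).1 h

theorem exists_integral_nearestDist_le (hk : 0 < k) {μ ν : Measure ℝ}
    [IsProbabilityMeasure μ] {a b : ℝ} (hI : μ.support ⊆ Icc a b) (hν : IsProjection k μ ν) :
    ∃ y : Fin k → ℝ, ∫ x, nearestDist y x ∂μ ≤ (W1 μ ν).toReal := by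
  obtain ⟨x, w, hw, hνeq⟩ := hν.1
  refine ⟨x, integral_nearestDist_le_of_concentrated hk hI (W1_ne_top_of_isProjection hI hk hν) ?_⟩
  have hs : MeasurableSet (range x)ᶜ := (finite_range x).measurableSet.compl
  rw [hνeq]
  simp [Measure.dirac_apply' _ hs]

theorem integral_nearestDist_le_add_W1 (hk : 0 < k) {μ μt : Measure ℝ}
    [IsProbabilityMeasure μ] [IsProbabilityMeasure μt] {a b : ℝ} (hI : μ.support ⊆ Icc a b)
    (hIt : μt.support ⊆ Icc a b) (y : Fin k → ℝ) :
    ∫ x, nearestDist y x ∂μ ≤ ∫ x, nearestDist y x ∂μt + (W1 μ μt).toReal := by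
  have hfin : W1 μ μt ≠ ⊤ := ne_top_of_le_ne_top (WInf_ne_top hI hIt) (W1_le_WInf μ μt)
  have h := lintegral_le_lintegral_add_W1 (α := μ) (β := μt)
    (continuous_nearestDist hk y).measurable (nearestDist_nonneg y)
    (nearestDist_le_add_abs_sub hk y)
  rw [lintegral_nearestDist_eq hk hI, lintegral_nearestDist_eq hk hIt,
    ← ENNReal.ofReal_toReal hfin, ← ENNReal.ofReal_add (integral_nonneg (nearestDist_nonneg y))
      ENNReal.toReal_nonneg] at h
  exact (ENNReal.ofReal_le_ofReal_iff
    (add_nonneg (integral_nonneg (nearestDist_nonneg y)) ENNReal.toReal_nonneg)).1 h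

theorem IsOptimalPercentileVector.mem_Icc {ζ : Measure ℝ} {v : Fin k → ℝ}
    (h : IsOptimalPercentileVector ζ v) (j : Fin k) : v j ∈ Icc (0 : ℝ) 1 := by
  obtain ⟨ν, y, -, -, -, hv⟩ := h
  rw [hv j]
  exact ⟨cdf_nonneg _ _, cdf_le_one _ _⟩

/-- The limiting positions of the facilities, and the cost of these. -/
theorem exists_quantiles_integral_le (hk : 0 < k) {μ μt ν : Measure ℝ}
    [IsProbabilityMeasure μ] [IsProbabilityMeasure μt] {a b : ℝ} (hμ : IsRegularDistribution μ)
    (hI : μ.support ⊆ Icc a b) (hIt : μt.support ⊆ Icc a b) (hν : IsProjection k μ ν)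
    {v : Fin k → ℝ} (hv : IsOptimalPercentileVector μt v) :
    ∃ q : Fin k → ℝ, (∀ j, q j ∈ Icc a b ∧ IsQuantile μ (v j) (q j)) ∧
      ∫ x, nearestDist q x ∂μ ≤
        (W1 μ ν).toReal + ((WInf μ μt).toReal + 2 * (W1 μ μt).toReal) := by
  have := hμ.nullSingletonClass
  choose q hq using fun j => exists_isQuantile hμ.1 hI (hv.mem_Icc j)
  refine ⟨q, hq, ?_⟩
  obtain ⟨νt, y, hνt, -, hsupp, hvy⟩ := hv
  have hfint := W1_ne_top_of_isProjection hIt hk hνt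
  have hqy : ∀ j, |q j - y j| ≤ (WInf μ μt).toReal := fun j => by
    have hy : y j ∈ νt.support := hsupp ▸ mem_range_self j
    exact IsQuantile.abs_sub_le_WInf (hvy j ▸ (hq j).2) (WInf_ne_top hI hIt)
      (fun ε hε => cdf_pos_of_mem_support_projection hνt hfint hy hε)
      (fun ε hε => cdf_lt_one_of_mem_support_projection hνt hfint hy hε)
  obtain ⟨z, hz⟩ := exists_integral_nearestDist_le hk hI hν
  have h1 : ∫ x, nearestDist q x ∂μ ≤ ∫ x, nearestDist y x ∂μ + (WInf μ μt).toReal := by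
    have : ∫ x, (nearestDist y x + (WInf μ μt).toReal) ∂μ =
        ∫ x, nearestDist y x ∂μ + (WInf μ μt).toReal := by
      rw [integral_add (integrable_nearestDist hk hI y) (integrable_const _)]
      simp
    rw [← this]
    refine integral_mono (integrable_nearestDist hk hI q)
      ((integrable_nearestDist hk hI y).add (integrable_const _)) fun x => ?_
    refine nearestDist_le_add hk fun j => ?_
    have := abs_sub_le x (y j) (q j)
    rw [abs_sub_comm (y j)] at this
    linarith [hqy j]
  have h2 := integral_nearestDist_le_add_W1 hk hI hIt y
  have h3 : ∫ x, nearestDist y x ∂μt ≤ (W1 μt νt).toReal :=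
    integral_nearestDist_le_of_concentrated hk hIt hfint
      (hsupp ▸ Measure.measure_compl_support)
  have h4 := W1_toReal_le_integral_nearestDist hk hIt hνt z
  have h5 := integral_nearestDist_le_add_W1 hk hIt hI z
  rw [W1_comm μt μ] at h5
  linarith

theorem W1_toReal_pos (hk : 0 < k) {μ ν : Measure ℝ} [IsProbabilityMeasure μ] [NullSingletonClass μ]
    {a b : ℝ} (hI : μ.support ⊆ Icc a b) (hν : IsProjection k μ ν) : 0 < (W1 μ ν).toReal := by
  obtain ⟨y, hy⟩ := exists_integral_nearestDist_le hk hI hν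
  refine lt_of_lt_of_le ?_ hy
  rw [integral_pos_iff_support_of_nonneg (nearestDist_nonneg y) (integrable_nearestDist hk hI y)]
  have hsub : (range y)ᶜ ⊆ Function.support (nearestDist y) := by
    intro x hx h0
    obtain ⟨j, hj⟩ := exists_nearestDist_eq hk y x
    have h0 : nearestDist y x = 0 := h0
    rw [h0, eq_comm, abs_eq_zero, sub_eq_zero] at hj
    exact hx ⟨j, hj.symm⟩
  refine lt_of_lt_of_le ?_ (measure_mono hsub)
  have h0 : μ (range y) = 0 := (finite_range y).measure_zero μ
  rw [(prob_compl_eq_one_iff (finite_range y).measurableSet).2 h0]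
  exact one_pos

end Comparison

section Empirical

/-- The empirical c.d.f. of the sample `x`. -/
noncomputable def empiricalCdf {n : ℕ} (x : Fin n → ℝ) (t : ℝ) : ℝ :=
  (Finset.univ.filter fun i => x i ≤ t).card / (n : ℝ)

variable {n : ℕ}

theorem empiricalCdf_eq (x : Fin n → ℝ) (t : ℝ) :
    empiricalCdf x t = (1 / (n : ℝ)) * ∑ i, (Iic t).indicator (fun _ => (1 : ℝ)) (x i) := by
  rw [empiricalCdf, Finset.card_filter]
  push_cast
  rw [div_eq_inv_mul, one_div]
  congr 1

theorem measurable_empiricalCdf (t : ℝ) : Measurable fun x : Fin n → ℝ => empiricalCdf x t := by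
  simp only [empiricalCdf_eq]
  refine Measurable.const_mul (Finset.measurable_sum _ fun i _ => ?_) _
  exact (measurable_const.indicator measurableSet_Iic).comp (measurable_pi_apply i)

theorem empiricalCdf_nonneg (x : Fin n → ℝ) (t : ℝ) : 0 ≤ empiricalCdf x t := by
  rw [empiricalCdf]; positivity

theorem empiricalCdf_le_one (x : Fin n → ℝ) (t : ℝ) : empiricalCdf x t ≤ 1 := by
  rw [empiricalCdf]
  refine div_le_one_of_le₀ ?_ (Nat.cast_nonneg n)
  exact_mod_cast (Finset.card_filter_le _ _).trans (by simp)

theorem abs_empiricalCdf_sub_cdf_le_one (μ : Measure ℝ) (x : Fin n → ℝ) (t : ℝ) :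
    |empiricalCdf x t - cdf μ t| ≤ 1 := by
  rw [abs_le]
  constructor <;> linarith [empiricalCdf_nonneg x t, empiricalCdf_le_one x t, cdf_nonneg μ t,
    cdf_le_one μ t]

variable {μ : Measure ℝ} [IsProbabilityMeasure μ]

theorem integrable_empiricalCdf_sub_sq (t : ℝ) :
    Integrable (fun x : Fin n → ℝ => (empiricalCdf x t - cdf μ t) ^ 2)
      (Measure.pi fun _ => μ) := by
  refine Integrable.of_bound (((measurable_empiricalCdf t).sub_const _).pow_const 2
    ).aestronglyMeasurable 1 (ae_of_all _ fun x => ?_)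
  rw [Real.norm_eq_abs, abs_pow]
  exact pow_le_one₀ (abs_nonneg _) (abs_empiricalCdf_sub_cdf_le_one μ x t)

theorem integral_empiricalCdf_sub_sq_le (hn : 0 < n) (t : ℝ) :
    ∫ x : Fin n → ℝ, (empiricalCdf x t - cdf μ t) ^ 2 ∂(Measure.pi fun _ => μ)
      ≤ 1 / (4 * n) := by
  set f : ℝ → ℝ := (Iic t).indicator fun _ => 1
  have hf : Measurable f := measurable_const.indicator measurableSet_Iic
  have hf01 : ∀ x, f x ∈ Icc (0 : ℝ) 1 := fun x => by
    by_cases h : x ∈ Iic t <;> simp [f, h]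
  have hfL : MemLp f 2 μ := MemLp.of_bound hf.aestronglyMeasurable 1 (ae_of_all _ fun x => by
    rw [Real.norm_eq_abs, abs_of_nonneg (hf01 x).1]; exact (hf01 x).2)
  have hint : ∫ x, f x ∂μ = cdf μ t := by
    rw [integral_indicator_const _ measurableSet_Iic, cdf_eq_real]; simp
  have hvar : Var[f; μ] ≤ 1 / 4 := by
    refine (variance_le_sq_of_bounded (ae_of_all _ hf01) hf.aemeasurable).trans (by norm_num)
  have hsum := variance_sum_pi (ι := Fin n) (μ := fun _ => μ) (X := fun _ => f) fun _ => hfL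
  have hmean : ∫ x : Fin n → ℝ, (∑ i, fun ω : Fin n → ℝ => f (ω i)) x ∂(Measure.pi fun _ => μ)
      = n * cdf μ t := by
    simp only [Finset.sum_apply]
    rw [integral_finsetSum]
    · simp [integral_comp_eval (μ := fun _ : Fin n => μ) (f := f) hf.aestronglyMeasurable, hint]
    · intro i _
      exact (measurePreserving_eval (fun _ => μ) i).integrable_comp_of_integrable
        (hfL.integrable one_le_two)
  rw [variance_eq_integral (by fun_prop), hmean] at hsum
  have hn' : (0 : ℝ) < n := by exact_mod_cast hn
  have heq : ∀ x : Fin n → ℝ, (empiricalCdf x t - cdf μ t) ^ 2 =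
      (1 / (n : ℝ) ^ 2) * ((∑ i, fun ω : Fin n → ℝ => f (ω i)) x - n * cdf μ t) ^ 2 := by
    intro x
    rw [empiricalCdf_eq, Finset.sum_apply]
    field_simp
    rfl
  simp only [heq]
  rw [integral_const_mul, hsum]
  simp only [Finset.sum_const, Finset.card_univ, Fintype.card_fin, nsmul_eq_mul]
  calc 1 / (n : ℝ) ^ 2 * (n * Var[f; μ]) ≤ 1 / (n : ℝ) ^ 2 * (n * (1 / 4)) := by gcongr
    _ = 1 / (4 * (n : ℝ)) := by field_simp

theorem measureReal_le_abs_empiricalCdf_sub_le (hn : 0 < n) (t : ℝ) {c : ℝ} (hc : 0 < c) :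
    (Measure.pi fun _ : Fin n => μ).real {x | c ≤ |empiricalCdf x t - cdf μ t|}
      ≤ 1 / (4 * n * c ^ 2) := by
  have h := mul_meas_ge_le_integral_of_nonneg (μ := Measure.pi fun _ : Fin n => μ)
    (ae_of_all _ fun x => sq_nonneg (empiricalCdf x t - cdf μ t))
    (integrable_empiricalCdf_sub_sq t) (c ^ 2)
  have hset : {x : Fin n → ℝ | c ^ 2 ≤ (empiricalCdf x t - cdf μ t) ^ 2} =
      {x | c ≤ |empiricalCdf x t - cdf μ t|} := by
    ext x
    simp only [mem_ofPred_eq]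
    rw [sq_le_sq, abs_of_pos hc]
  rw [hset] at h
  have h2 := h.trans (integral_empiricalCdf_sub_sq_le hn t)
  have hn' : (0 : ℝ) < n := by exact_mod_cast hn
  rw [le_div_iff₀ (by positivity)] at h2 ⊢
  linarith

theorem ae_pi_forall {p : ℝ → Prop} (h : ∀ᵐ x ∂μ, p x) :
    ∀ᵐ x ∂(Measure.pi fun _ : Fin n => μ), ∀ i, p (x i) :=
  ae_all_iff.2 fun i =>
    (measurePreserving_eval (fun _ : Fin n => μ) i).quasiMeasurePreserving.ae h

end Empirical

section Percentile

variable {n : ℕ}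

/-- The sample percentile that the mechanism uses for a facility with percentile `p`. -/
noncomputable def samplePercentile (p : ℝ) (x : Fin n → ℝ) : ℝ :=
  if h : ⌊((n : ℝ) - 1) * p⌋₊ < n then x (Tuple.sort x ⟨⌊((n : ℝ) - 1) * p⌋₊, h⟩) else 0

theorem percentileMechanism_apply {k : ℕ} (v : Fin k → ℝ) (x : Fin n → ℝ) (j : Fin k) :
    percentileMechanism v x j = samplePercentile (v j) x := rfl

theorem samplePercentile_le_iff (hn : 0 < n) {p : ℝ} (hp : p ∈ Icc (0 : ℝ) 1) (x : Fin n → ℝ)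
    (t : ℝ) : samplePercentile p x ≤ t ↔
      ⌊((n : ℝ) - 1) * p⌋₊ < (Finset.univ.filter fun i => x i ≤ t).card := by
  rw [samplePercentile, dif_pos (floor_lt_of_mem hn hp)]
  have h := Tuple.lt_card_le_iff_apply_le_of_monotone (f := x ∘ Tuple.sort x) (a := t)
    (j := ⟨_, floor_lt_of_mem hn hp⟩) (Tuple.monotone_sort x)
  have hcard : (Finset.univ.filter fun i => (x ∘ Tuple.sort x) i ≤ t).card =
      (Finset.univ.filter fun i => x i ≤ t).card :=
    Finset.card_equiv (Tuple.sort x) fun i => by simp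
  rw [hcard] at h
  exact h.symm

theorem samplePercentile_mem_range (hn : 0 < n) {p : ℝ} (hp : p ∈ Icc (0 : ℝ) 1)
    (x : Fin n → ℝ) : ∃ i, samplePercentile p x = x i := by
  rw [samplePercentile, dif_pos (floor_lt_of_mem hn hp)]
  exact ⟨_, rfl⟩

theorem samplePercentile_zero_le (hn : 0 < n) (x : Fin n → ℝ) (i : Fin n) :
    samplePercentile 0 x ≤ x i := by
  rw [samplePercentile_le_iff hn ⟨le_rfl, zero_le_one⟩]
  simp only [mul_zero, Nat.floor_zero]
  exact Finset.card_pos.2 ⟨i, by simp⟩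

theorem le_samplePercentile_one (hn : 0 < n) (x : Fin n → ℝ) (i : Fin n) :
    x i ≤ samplePercentile 1 x := by
  have h := (samplePercentile_le_iff hn ⟨zero_le_one, le_rfl⟩ x _).1 le_rfl
  have h1 : ⌊((n : ℝ) - 1) * 1⌋₊ = n - 1 := by
    rw [mul_one, ← Nat.cast_one, ← Nat.cast_sub hn, Nat.floor_natCast]
  rw [h1] at h
  have h2 : (Finset.univ.filter fun i => x i ≤ samplePercentile 1 x) = Finset.univ := by
    rw [← Finset.card_eq_iff_eq_univ, Fintype.card_fin]
    have h3 := Finset.card_filter_le (Finset.univ : Finset (Fin n))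
      fun i => x i ≤ samplePercentile 1 x
    rw [Finset.card_univ, Fintype.card_fin] at h3
    omega
  have h4 : i ∈ Finset.univ.filter fun i => x i ≤ samplePercentile 1 x := by simp [h2]
  simpa using h4

theorem measurable_samplePercentile (hn : 0 < n) {p : ℝ} (hp : p ∈ Icc (0 : ℝ) 1) :
    Measurable (samplePercentile p : (Fin n → ℝ) → ℝ) := by
  refine measurable_of_Iic fun t => ?_
  have hm : Measurable fun x : Fin n → ℝ => (Finset.univ.filter fun i => x i ≤ t).card := by
    simp only [Finset.card_filter]
    refine Finset.measurable_sum _ fun i _ => Measurable.ite ?_ measurable_const measurable_const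
    exact measurableSet_le (measurable_pi_apply i) measurable_const
  have hset : (samplePercentile p : (Fin n → ℝ) → ℝ) ⁻¹' Iic t =
      {x | ⌊((n : ℝ) - 1) * p⌋₊ < (Finset.univ.filter fun i => x i ≤ t).card} := by
    ext x
    exact samplePercentile_le_iff hn hp x t
  rw [hset]
  exact measurableSet_lt measurable_const hm

theorem empiricalCdf_le_of_lt_samplePercentile (hn : 0 < n) {p : ℝ} (hp : p ∈ Icc (0 : ℝ) 1)
    {x : Fin n → ℝ} {t : ℝ} (h : t < samplePercentile p x) : empiricalCdf x t ≤ p := by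
  rw [← not_le, samplePercentile_le_iff hn hp, not_lt] at h
  have hn' : (1 : ℝ) ≤ n := by exact_mod_cast hn
  rw [empiricalCdf, div_le_iff₀ (by linarith)]
  have h1 : ((Finset.univ.filter fun i => x i ≤ t).card : ℝ) ≤ ⌊((n : ℝ) - 1) * p⌋₊ := by
    exact_mod_cast h
  have h2 := Nat.floor_le (mul_nonneg (show (0 : ℝ) ≤ (n : ℝ) - 1 by linarith) hp.1)
  nlinarith [hp.1]

theorem sub_le_empiricalCdf_of_samplePercentile_le (hn : 0 < n) {p : ℝ} (hp : p ∈ Icc (0 : ℝ) 1)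
    {x : Fin n → ℝ} {t : ℝ} (h : samplePercentile p x ≤ t) :
    p - 1 / n ≤ empiricalCdf x t := by
  rw [samplePercentile_le_iff hn hp] at h
  have hn' : (1 : ℝ) ≤ n := by exact_mod_cast hn
  have hn0 : (0 : ℝ) < n := by linarith
  rw [empiricalCdf, le_div_iff₀ hn0, sub_mul, one_div, inv_mul_cancel₀ hn0.ne']
  have h1 : (⌊((n : ℝ) - 1) * p⌋₊ : ℝ) + 1 ≤ (Finset.univ.filter fun i => x i ≤ t).card := by
    exact_mod_cast h
  have h2 := Nat.lt_floor_add_one (((n : ℝ) - 1) * p)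
  nlinarith [hp.2]

variable {μ : Measure ℝ} [IsProbabilityMeasure μ]

theorem ae_le_of_cdf_eq_one {t : ℝ} (h : cdf μ t = 1) : ∀ᵐ x ∂μ, x ≤ t := by
  rw [cdf_eq_real, measureReal_def, ENNReal.toReal_eq_one_iff, ← prob_compl_eq_zero_iff
    measurableSet_Iic] at h
  exact h

theorem ae_lt_of_cdf_eq_zero {t : ℝ} (h : cdf μ t = 0) : ∀ᵐ x ∂μ, t < x := by
  rw [cdf_eq_real, measureReal_eq_zero_iff] at h
  filter_upwards [measure_eq_zero_iff_ae_notMem.1 h] with x hx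
  simpa using hx

theorem measureReal_lt_abs_samplePercentile_sub_le (hn : 0 < n) {p : ℝ} (hp : p ∈ Icc (0 : ℝ) 1)
    {q s γ : ℝ} (hγ : 0 < γ) (hγn : 2 / n ≤ γ)
    (hup : p + γ ≤ cdf μ (q + s) ∨ cdf μ (q + s) = 1)
    (hlo : cdf μ (q - s) ≤ p - γ ∨ cdf μ (q - s) = 0) :
    (Measure.pi fun _ : Fin n => μ).real {x | s < |samplePercentile p x - q|}
      ≤ 2 / (n * γ ^ 2) := by
  set P := Measure.pi fun _ : Fin n => μ
  set U : Set (Fin n → ℝ) := {x | γ / 2 ≤ |empiricalCdf x (q + s) - cdf μ (q + s)|}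
  set V : Set (Fin n → ℝ) := {x | γ / 2 ≤ |empiricalCdf x (q - s) - cdf μ (q - s)|}
  have hn' : (0 : ℝ) < n := by exact_mod_cast hn
  have hγn' : 1 / (n : ℝ) ≤ γ / 2 := by
    have : 2 / (n : ℝ) = 2 * (1 / n) := by ring
    linarith
  have hU : ∀ᵐ x ∂P, q + s < samplePercentile p x → x ∈ U := by
    rcases hup with h | h
    · refine ae_of_all _ fun x hx => ?_
      have h1 := empiricalCdf_le_of_lt_samplePercentile hn hp hx
      change γ / 2 ≤ |empiricalCdf x (q + s) - cdf μ (q + s)|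
      rw [abs_sub_comm]
      exact le_trans (by linarith) (le_abs_self _)
    · filter_upwards [ae_pi_forall (n := n) (ae_le_of_cdf_eq_one h)] with x hx hlt
      obtain ⟨i, hi⟩ := samplePercentile_mem_range hn hp x
      linarith [hx i]
  have hV : ∀ᵐ x ∂P, samplePercentile p x < q - s → x ∈ V := by
    rcases hlo with h | h
    · refine ae_of_all _ fun x hx => ?_
      have h1 := sub_le_empiricalCdf_of_samplePercentile_le hn hp hx.le
      change γ / 2 ≤ |empiricalCdf x (q - s) - cdf μ (q - s)|
      exact le_trans (by linarith) (le_abs_self _)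
    · filter_upwards [ae_pi_forall (n := n) (ae_lt_of_cdf_eq_zero h)] with x hx hlt
      obtain ⟨i, hi⟩ := samplePercentile_mem_range hn hp x
      linarith [hx i]
  have hsub : P {x | s < |samplePercentile p x - q|} ≤ P (U ∪ V) := by
    refine measure_mono_ae ?_
    filter_upwards [hU, hV] with x h1 h2 hx
    rcases lt_abs.1 (show s < |samplePercentile p x - q| from hx) with h | h
    · exact Or.inl (h1 (by linarith))
    · exact Or.inr (h2 (by linarith))
  have h1 : P.real {x | s < |samplePercentile p x - q|} ≤ P.real U + P.real V :=
    (ENNReal.toReal_mono (measure_ne_top _ _) hsub).trans (measureReal_union_le U V)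
  have h2 := measureReal_le_abs_empiricalCdf_sub_le (μ := μ) hn (q + s) (half_pos hγ)
  have h3 := measureReal_le_abs_empiricalCdf_sub_le (μ := μ) hn (q - s) (half_pos hγ)
  have h4 : 1 / (4 * n * (γ / 2) ^ 2) + 1 / (4 * n * (γ / 2) ^ 2) = 2 / (n * γ ^ 2) := by
    field_simp; norm_num
  linarith

theorem ae_abs_samplePercentile_sub_le (hn : 0 < n) {p : ℝ} (hp : p ∈ Icc (0 : ℝ) 1) {a b q : ℝ}
    (hI : μ.support ⊆ Icc a b) (hq : q ∈ Icc a b) :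
    ∀ᵐ x ∂(Measure.pi fun _ : Fin n => μ), |samplePercentile p x - q| ≤ b - a := by
  filter_upwards [ae_pi_forall (n := n) (ae_mem_of_support_subset hI)] with x hx
  obtain ⟨i, hi⟩ := samplePercentile_mem_range hn hp x
  rw [hi]
  exact abs_le.2 ⟨by linarith [(hx i).1, hq.2], by linarith [(hx i).2, hq.1]⟩

theorem integrable_abs_samplePercentile_sub (hn : 0 < n) {p : ℝ} (hp : p ∈ Icc (0 : ℝ) 1)
    {a b q : ℝ} (hI : μ.support ⊆ Icc a b) (hq : q ∈ Icc a b) :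
    Integrable (fun x => |samplePercentile p x - q|) (Measure.pi fun _ : Fin n => μ) := by
  have hm := measurable_samplePercentile hn hp
  refine Integrable.of_bound (by fun_prop) (b - a) ?_
  filter_upwards [ae_abs_samplePercentile_sub_le hn hp hI hq] with x hx
  rwa [Real.norm_eq_abs, abs_abs]

theorem tendsto_integral_abs_samplePercentile_sub {p : ℝ} (hp : p ∈ Icc (0 : ℝ) 1)
    {a b q : ℝ} (hI : μ.support ⊆ Icc a b) (hq : q ∈ Icc a b) (hqp : IsQuantile μ p q) :
    Tendsto (fun n : ℕ => ∫ x, |samplePercentile p x - q| ∂(Measure.pi fun _ : Fin n => μ))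
      atTop (𝓝 0) := by
  rw [Metric.tendsto_atTop']
  intro ε hε
  obtain ⟨γ, hγ, hup, hlo⟩ : ∃ γ > 0, (p + γ ≤ cdf μ (q + ε / 2) ∨ cdf μ (q + ε / 2) = 1) ∧
      (cdf μ (q - ε / 2) ≤ p - γ ∨ cdf μ (q - ε / 2) = 0) := by
    have h1 : ∃ γ > 0, (p + γ ≤ cdf μ (q + ε / 2) ∨ cdf μ (q + ε / 2) = 1) := by
      rcases hqp.of_gt (q + ε / 2) (by linarith) with h | h
      · exact ⟨_, sub_pos.2 h, Or.inl (by linarith)⟩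
      · exact ⟨1, one_pos, Or.inr h⟩
    have h2 : ∃ γ > 0, (cdf μ (q - ε / 2) ≤ p - γ ∨ cdf μ (q - ε / 2) = 0) := by
      rcases hqp.of_lt (q - ε / 2) (by linarith) with h | h
      · exact ⟨_, sub_pos.2 h, Or.inl (by linarith)⟩
      · exact ⟨1, one_pos, Or.inr h⟩
    obtain ⟨γ₁, h1, h1'⟩ := h1
    obtain ⟨γ₂, h2, h2'⟩ := h2
    exact ⟨min γ₁ γ₂, lt_min h1 h2, h1'.imp_left fun h => by linarith [min_le_left γ₁ γ₂],
      h2'.imp_left fun h => by linarith [min_le_right γ₁ γ₂]⟩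
  have hba : 0 ≤ b - a := by linarith [hq.1, hq.2]
  have ht1 : Tendsto (fun n : ℕ => 2 / (n : ℝ)) atTop (𝓝 0) :=
    tendsto_const_div_atTop_nhds_zero_nat 2
  have ht2 : Tendsto (fun n : ℕ => (b - a) * (2 / γ ^ 2) / (n : ℝ)) atTop (𝓝 0) :=
    tendsto_const_div_atTop_nhds_zero_nat _
  obtain ⟨N, hN⟩ := eventually_atTop.1 ((ht1.eventually_lt_const hγ).and
    ((ht2.eventually_lt_const (half_pos hε)).and (eventually_gt_atTop 0)))
  refine ⟨N, fun n hnN => ?_⟩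
  obtain ⟨h1, h2, hn⟩ := hN n hnN.le
  have hint := integrable_abs_samplePercentile_sub hn hp hI hq
  set P := Measure.pi fun _ : Fin n => μ
  set A : Set (Fin n → ℝ) := {x | ε / 2 < |samplePercentile p x - q|}
  have hA : MeasurableSet A := by
    have hm := measurable_samplePercentile hn hp
    exact measurableSet_lt measurable_const (by fun_prop)
  have hdev := measureReal_lt_abs_samplePercentile_sub_le hn hp hγ h1.le hup hlo
  have hle : ∫ x, |samplePercentile p x - q| ∂P ≤
      ∫ x, (ε / 2 + A.indicator (fun _ => b - a) x) ∂P := by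
    refine integral_mono_ae hint ((integrable_const _).add
      ((integrable_const _).indicator hA)) ?_
    filter_upwards [ae_abs_samplePercentile_sub_le hn hp hI hq] with x hx
    by_cases hxA : x ∈ A
    · rw [indicator_of_mem hxA]; linarith
    · rw [indicator_of_notMem hxA, add_zero]
      exact not_lt.1 hxA
  rw [integral_add (integrable_const _) ((integrable_const _).indicator hA),
    integral_indicator_const _ hA] at hle
  simp only [integral_const, probReal_univ, smul_eq_mul, one_mul] at hle
  rw [Real.dist_eq, sub_zero, abs_of_nonneg (integral_nonneg fun x => abs_nonneg _)]
  have h3 : P.real A * (b - a) ≤ (b - a) * (2 / γ ^ 2) / n := by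
    refine (mul_le_mul_of_nonneg_right hdev hba).trans (le_of_eq ?_)
    field_simp
  linarith

theorem integral_le_of_measureReal_lt_le {Ω : Type*} [MeasurableSpace Ω] {P : Measure Ω}
    [IsProbabilityMeasure P] {f : Ω → ℝ} (hf : Integrable f P) (h0 : ∀ ω, 0 ≤ f ω) {h K : ℝ}
    (hh : 0 < h) (hK : 0 ≤ K) (htail : ∀ s, h < s → P.real {ω | s < f ω} ≤ K / s ^ 2) :
    ∫ ω, f ω ∂P ≤ h + K / h := by
  rw [← ENNReal.ofReal_le_ofReal_iff (by positivity), ofReal_integral_eq_lintegral_ofReal hf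
    (ae_of_all _ h0), lintegral_eq_lintegral_meas_lt P (ae_of_all _ h0) hf.aemeasurable,
    ← Ioc_union_Ioi_eq_Ioi hh.le, ENNReal.ofReal_add hh.le (by positivity)]
  refine (lintegral_union_le _ _ _).trans (add_le_add ?_ ?_)
  · calc ∫⁻ s in Ioc 0 h, P {ω | s < f ω} ≤ ∫⁻ _ in Ioc 0 h, 1 :=
          lintegral_mono fun s => prob_le_one
      _ = ENNReal.ofReal h := by simp
  · have hint : IntegrableOn (fun s : ℝ => K * s ^ (-2 : ℝ)) (Ioi h) :=
      (integrableOn_Ioi_rpow_of_lt (by norm_num) hh).const_mul K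
    calc ∫⁻ s in Ioi h, P {ω | s < f ω}
        ≤ ∫⁻ s in Ioi h, ENNReal.ofReal (K * s ^ (-2 : ℝ)) := by
          refine setLIntegral_mono_ae (by fun_prop) (ae_of_all _ fun s hs => ?_)
          have hs' : 0 < s := hh.trans hs
          rw [ENNReal.le_ofReal_iff_toReal_le (measure_ne_top _ _) (by positivity)]
          refine (htail s hs).trans (le_of_eq ?_)
          rw [Real.rpow_neg hs'.le, div_eq_mul_inv]
          norm_cast
      _ = ENNReal.ofReal (∫ s in Ioi h, K * s ^ (-2 : ℝ)) := by
          refine (ofReal_integral_eq_lintegral_ofReal hint ?_).symm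
          filter_upwards [ae_restrict_mem measurableSet_Ioi] with s hs
          have hs' : 0 < s := hh.trans hs
          exact mul_nonneg hK (Real.rpow_nonneg hs'.le _)
      _ = ENNReal.ofReal (K / h) := by
          rw [integral_const_mul, integral_Ioi_rpow_of_lt (by norm_num) hh]
          congr 1
          norm_num
          rw [Real.rpow_neg_one, div_eq_mul_inv]

theorem exists_integral_abs_samplePercentile_sub_le (hμ : IsRegularDistribution μ) {p : ℝ}
    (hp0 : 0 < p) (hp1 : p < 1) {a b q : ℝ} (hI : μ.support ⊆ Icc a b) (hq : q ∈ Icc a b)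
    (hqp : IsQuantile μ p q) :
    ∃ C : ℝ, 0 ≤ C ∧ ∀ n : ℕ, 0 < n →
      ∫ x, |samplePercentile p x - q| ∂(Measure.pi fun _ : Fin n => μ) ≤ C / Real.sqrt n := by
  have hp : p ∈ Icc (0 : ℝ) 1 := ⟨hp0.le, hp1.le⟩
  have hba : 0 ≤ b - a := by linarith [hq.1, hq.2]
  obtain ⟨c, hc, hgrow⟩ := hμ.exists_linear_growth (q := q) (by rw [hqp.cdf_eq]; exact hp0)
    (by rw [hqp.cdf_eq]; exact hp1) hba
  rw [hqp.cdf_eq] at hgrow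
  refine ⟨(1 + 2 / c) + 2 / c ^ 2, by positivity, fun n hn => ?_⟩
  have hn1 : (1 : ℝ) ≤ n := by exact_mod_cast hn
  have hn0 : (0 : ℝ) < n := by linarith
  have hr : 0 < Real.sqrt n := Real.sqrt_pos.2 hn0
  have hrr : Real.sqrt n * Real.sqrt n = n := Real.mul_self_sqrt hn0.le
  have hrn : Real.sqrt n ≤ n := by nlinarith [Real.one_le_sqrt.2 hn1]
  set h := (1 + 2 / c) / Real.sqrt n with hdef
  have hh : 0 < h := by positivity
  have htail : ∀ s, h < s → (Measure.pi fun _ : Fin n => μ).real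
      {x | s < |samplePercentile p x - q|} ≤ 2 / (n * c ^ 2) / s ^ 2 := by
    intro s hs
    have hs0 : 0 < s := hh.trans hs
    rcases lt_or_ge (b - a) s with hbs | hsb
    · have : (Measure.pi fun _ : Fin n => μ) {x | s < |samplePercentile p x - q|} = 0 := by
        refine measure_eq_zero_iff_ae_notMem.2 ?_
        filter_upwards [ae_abs_samplePercentile_sub_le hn hp hI hq] with x hx hx'
        exact absurd (hx.trans_lt hbs) (not_lt.2 (le_of_lt hx'))
      rw [measureReal_def, this, ENNReal.toReal_zero]
      positivity
    · have h1 := hgrow (q + s) (by rwa [add_sub_cancel_left, abs_of_pos hs0])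
      have h2 := hgrow (q - s) (by
        rwa [sub_sub_cancel_left, abs_neg, abs_of_pos hs0])
      rw [add_sub_cancel_left, abs_of_pos hs0, abs_of_nonneg
        (by linarith [hqp.cdf_eq, monotone_cdf μ (show q ≤ q + s by linarith)])] at h1
      rw [sub_sub_cancel_left, abs_neg, abs_of_pos hs0, abs_of_nonpos
        (by linarith [hqp.cdf_eq, monotone_cdf μ (show q - s ≤ q by linarith)])] at h2
      have hγn : 2 / (n : ℝ) ≤ c * s := by
        have h3 : 2 / (n : ℝ) ≤ 2 / Real.sqrt n := by gcongr
        have h4 : 2 / Real.sqrt n ≤ c * h := by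
          rw [hdef, mul_div_assoc', div_le_div_iff_of_pos_right hr]
          have : c * (1 + 2 / c) = c + 2 := by field_simp
          linarith
        have h5 : c * h ≤ c * s := by gcongr
        linarith
      refine (measureReal_lt_abs_samplePercentile_sub_le hn hp (by positivity) hγn
        (Or.inl (by linarith)) (Or.inl (by linarith))).trans (le_of_eq ?_)
      field_simp
  refine (integral_le_of_measureReal_lt_le (integrable_abs_samplePercentile_sub hn hp hI hq)
    (fun x => abs_nonneg _) hh (by positivity) htail).trans ?_
  have h6 : 2 / (n * c ^ 2) / h = 2 / c ^ 2 / (1 + 2 / c) / Real.sqrt n := by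
    rw [hdef]
    nth_rewrite 1 [← hrr]
    field_simp
  rw [h6, hdef, ← add_div]
  refine div_le_div_of_nonneg_right (add_le_add_right (div_le_self (by positivity) ?_) _) hr.le
  have : 0 < 2 / c := by positivity
  linarith

end Percentile

section LipschitzSampling

variable {n : ℕ}

/-- Approximation of a `1`-Lipschitz function by a step function with `N` equidistant jumps. -/
theorem abs_sub_step_le {g : ℝ → ℝ} (hg : ∀ x x', |g x - g x'| ≤ |x - x'|) {a h : ℝ} (hh : 0 < h)
    {N : ℕ} {x : ℝ} (hx : x ∈ Icc a (a + N * h)) :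
    |g x - (g a + ∑ l ∈ Finset.range N, (g (a + (l + 1 : ℕ) * h) - g (a + l * h)) *
      (1 - (Iic (a + l * h)).indicator (fun _ => (1 : ℝ)) x))| ≤ h := by
  set m := ⌈(x - a) / h⌉₊
  have hx0 : 0 ≤ (x - a) / h := div_nonneg (by linarith [hx.1]) hh.le
  have hmN : m ≤ N := Nat.ceil_le.2 ((div_le_iff₀ hh).2 (by linarith [hx.2]))
  have hind : ∀ l : ℕ, 1 - (Iic (a + l * h)).indicator (fun _ => (1 : ℝ)) x =
      if l < m then 1 else 0 := by
    intro l
    have hiff : l < m ↔ ¬ x ≤ a + l * h := by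
      rw [Nat.lt_ceil, lt_div_iff₀ hh, not_le]
      constructor <;> intro h' <;> linarith
    by_cases hl : l < m
    · rw [if_pos hl, indicator_of_notMem (by exact hiff.1 hl), sub_zero]
    · rw [if_neg hl, indicator_of_mem (by exact not_not.1 (hiff.not.1 hl)), sub_self]
  have hsum : ∑ l ∈ Finset.range N, (g (a + (l + 1 : ℕ) * h) - g (a + l * h)) *
      (1 - (Iic (a + l * h)).indicator (fun _ => (1 : ℝ)) x) = g (a + m * h) - g a := by
    simp only [hind, mul_ite, mul_one, mul_zero]
    rw [← Finset.sum_filter]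
    have : (Finset.range N).filter (fun l => l < m) = Finset.range m := by
      ext l; simp only [Finset.mem_filter, Finset.mem_range]; omega
    rw [this, Finset.sum_range_sub (fun l : ℕ => g (a + l * h))]
    simp
  rw [hsum, add_sub_cancel]
  refine (hg _ _).trans ?_
  have h1 : (x - a) / h ≤ m := Nat.le_ceil _
  have h2 : (m : ℝ) < (x - a) / h + 1 := Nat.ceil_lt_add_one hx0
  have h3 : (x - a) / h * h = x - a := div_mul_cancel₀ _ hh.ne'
  rw [abs_le]
  constructor <;> nlinarith

variable {μ : Measure ℝ} [IsProbabilityMeasure μ]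

theorem abs_mean_sub_integral_le (hn : 0 < n) {g : ℝ → ℝ} (hg : ∀ x x', |g x - g x'| ≤ |x - x'|)
    (hgi : Integrable g μ) {a h : ℝ} (hh : 0 < h) {N : ℕ}
    (hI : μ.support ⊆ Icc a (a + N * h)) {x : Fin n → ℝ} (hx : ∀ i, x i ∈ Icc a (a + N * h)) :
    |(1 / (n : ℝ)) * ∑ i, g (x i) - ∫ t, g t ∂μ| ≤
      2 * h + h * ∑ l ∈ Finset.range N, |empiricalCdf x (a + l * h) - cdf μ (a + l * h)| := by
  have hn0 : (0 : ℝ) < n := by exact_mod_cast hn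
  set Δ : ℕ → ℝ := fun l => g (a + (l + 1 : ℕ) * h) - g (a + l * h)
  set I : ℕ → ℝ → ℝ := fun l => (Iic (a + l * h)).indicator fun _ => (1 : ℝ)
  set S : ℝ → ℝ := fun t => g a + ∑ l ∈ Finset.range N, Δ l * (1 - I l t)
  have hΔ : ∀ l, |Δ l| ≤ h := fun l => by
    refine (hg _ _).trans (le_of_eq ?_)
    push_cast
    rw [show a + (l + 1) * h - (a + l * h) = h by ring, abs_of_pos hh]
  have hstep : ∀ t ∈ Icc a (a + N * h), |g t - S t| ≤ h := fun t ht => abs_sub_step_le hg hh ht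
  have hIi : ∀ l, Integrable (I l) μ := fun l =>
    (integrable_const _).indicator measurableSet_Iic
  have hΔi : ∀ l ∈ Finset.range N, Integrable (fun t => Δ l * (1 - I l t)) μ := fun l _ =>
    ((integrable_const _).sub (hIi l)).const_mul _
  have hSi : Integrable S μ := (integrable_const _).add (integrable_finsetSum _ hΔi)
  have hSint : ∫ t, S t ∂μ = g a + ∑ l ∈ Finset.range N, Δ l * (1 - cdf μ (a + l * h)) := by
    rw [integral_add (integrable_const _) (integrable_finsetSum _ hΔi),
      integral_finsetSum _ hΔi]
    simp only [integral_const, probReal_univ, smul_eq_mul, one_mul]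
    congr 1
    refine Finset.sum_congr rfl fun l _ => ?_
    rw [integral_const_mul, integral_sub (integrable_const _) (hIi l),
      integral_indicator_const _ measurableSet_Iic, cdf_eq_real]
    simp
  have hSmean : (1 / (n : ℝ)) * ∑ i, S (x i) =
      g a + ∑ l ∈ Finset.range N, Δ l * (1 - empiricalCdf x (a + l * h)) := by
    simp only [S, Finset.sum_add_distrib]
    have hcomm : ∑ i, ∑ l ∈ Finset.range N, Δ l * (1 - I l (x i)) =
        ∑ l ∈ Finset.range N, ∑ i, Δ l * (1 - I l (x i)) := Finset.sum_comm
    rw [hcomm, mul_add, Finset.mul_sum (Finset.range N)]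
    congr 1
    · simp only [Finset.sum_const, Finset.card_univ, Fintype.card_fin, nsmul_eq_mul]
      field_simp
    · refine Finset.sum_congr rfl fun l _ => ?_
      rw [empiricalCdf_eq, ← Finset.mul_sum, Finset.sum_sub_distrib]
      simp only [Finset.sum_const, Finset.card_univ, Fintype.card_fin, nsmul_eq_mul, I]
      field_simp
  have h1 : |(1 / (n : ℝ)) * ∑ i, g (x i) - (1 / (n : ℝ)) * ∑ i, S (x i)| ≤ h := by
    rw [← mul_sub, ← Finset.sum_sub_distrib, abs_mul, abs_of_pos (by positivity)]
    calc 1 / (n : ℝ) * |∑ i, (g (x i) - S (x i))| ≤ 1 / (n : ℝ) * ∑ i : Fin n, h := by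
          refine mul_le_mul_of_nonneg_left ((Finset.abs_sum_le_sum_abs _ _).trans
            (Finset.sum_le_sum fun i _ => hstep _ (hx i))) (by positivity)
      _ = h := by
          simp only [Finset.sum_const, Finset.card_univ, Fintype.card_fin, nsmul_eq_mul]
          field_simp
  have h2 : |∫ t, g t ∂μ - ∫ t, S t ∂μ| ≤ h := by
    rw [← integral_sub hgi hSi]
    have := norm_integral_le_of_norm_le_const (μ := μ) (f := fun t => g t - S t) (C := h) (by
      filter_upwards [ae_mem_of_support_subset hI] with t ht
      exact hstep t ht)
    simpa using this
  have h3 : |(1 / (n : ℝ)) * ∑ i, S (x i) - ∫ t, S t ∂μ| ≤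
      h * ∑ l ∈ Finset.range N, |empiricalCdf x (a + l * h) - cdf μ (a + l * h)| := by
    rw [hSmean, hSint, add_sub_add_left_eq_sub, ← Finset.sum_sub_distrib, Finset.mul_sum]
    refine (Finset.abs_sum_le_sum_abs _ _).trans (Finset.sum_le_sum fun l _ => ?_)
    rw [← mul_sub, abs_mul, sub_sub_sub_cancel_left, abs_sub_comm (cdf μ _)]
    exact mul_le_mul_of_nonneg_right (hΔ l) (abs_nonneg _)
  rw [abs_le] at *
  constructor <;> linarith [h1.1, h1.2, h2.1, h2.2, h3.1, h3.2]

end LipschitzSampling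

section OptimalCost

variable {n k : ℕ}

theorem prob_eq_one_of_ae_mem {Ω : Type*} [MeasurableSpace Ω] {P : Measure Ω}
    [IsProbabilityMeasure P] {s : Set Ω} (h : ∀ᵐ ω ∂P, ω ∈ s) : P s = 1 := by
  exact (measure_congr (eventuallyEq_univ.2 h)).trans measure_univ

theorem optimalCost_le (x : Fin n → ℝ) (y : Fin k → ℝ) : optimalCost k x ≤ socialCost x y :=
  ciInf_le ⟨0, by rintro _ ⟨z, rfl⟩; exact socialCost_nonneg x z⟩ y

theorem optimalCost_nonneg (x : Fin n → ℝ) : 0 ≤ optimalCost k x :=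
  Real.iInf_nonneg fun y => socialCost_nonneg x y

theorem mean_le {n : ℕ} {f : Fin n → ℝ} {c : ℝ} (hc : 0 ≤ c) (h : ∀ i, f i ≤ c) :
    1 / (n : ℝ) * ∑ i, f i ≤ c := by
  rcases Nat.eq_zero_or_pos n with rfl | hn
  · simpa using hc
  have hn0 : (0 : ℝ) < n := by exact_mod_cast hn
  calc 1 / (n : ℝ) * ∑ i, f i ≤ 1 / (n : ℝ) * ∑ i : Fin n, c :=
        mul_le_mul_of_nonneg_left (Finset.sum_le_sum fun i _ => h i) (by positivity)
    _ = c := by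
        simp only [Finset.sum_const, Finset.card_univ, Fintype.card_fin, nsmul_eq_mul]
        field_simp

theorem socialCost_le_add_dist (hk : 0 < k) (x x' : Fin n → ℝ) (y : Fin k → ℝ) :
    socialCost x y ≤ socialCost x' y + dist x x' := by
  rw [socialCost_eq, socialCost_eq, ← sub_le_iff_le_add', ← mul_sub, ← Finset.sum_sub_distrib]
  refine mean_le dist_nonneg fun i => ?_
  have h1 := nearestDist_le_add_abs_sub hk y (x i) (x' i)
  have h2 := dist_le_pi_dist x x' i
  rw [Real.dist_eq] at h2
  linarith

theorem continuous_optimalCost (hk : 0 < k) :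
    Continuous (optimalCost k : (Fin n → ℝ) → ℝ) := by
  have key : ∀ x x' : Fin n → ℝ, optimalCost k x ≤ optimalCost k x' + dist x x' := by
    intro x x'
    rw [← sub_le_iff_le_add]
    refine le_ciInf fun y => ?_
    linarith [optimalCost_le x y, socialCost_le_add_dist hk x x' y]
  refine (LipschitzWith.of_dist_le_mul (K := 1) fun x x' => ?_).continuous
  rw [Real.dist_eq, abs_le, NNReal.coe_one, one_mul]
  have h1 := key x x'
  have h2 := key x' x
  rw [dist_comm x' x] at h2
  constructor <;> linarith

theorem optimalCost_pos (hk : 0 < k) (hkn : k < n) {x : Fin n → ℝ} (hx : Function.Injective x) :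
    0 < optimalCost k x := by
  have hn0 : (0 : ℝ) < n := by exact_mod_cast hk.trans hkn
  have hne : (Finset.univ : Finset (Fin n)).offDiag.Nonempty :=
    ⟨(⟨0, by omega⟩, ⟨1, by omega⟩), by simp⟩
  obtain ⟨p, hp, hmin⟩ := Finset.exists_min_image _ (fun p => |x p.1 - x p.2|) hne
  have hδ : 0 < |x p.1 - x p.2| :=
    abs_pos.2 (sub_ne_zero.2 (hx.ne (Finset.mem_offDiag.1 hp).2.2))
  have hpos : 0 < 1 / (n : ℝ) * |x p.1 - x p.2| := by positivity
  refine hpos.trans_le (le_ciInf fun y => ?_)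
  choose f hf using fun i => exists_nearestDist_eq hk y (x i)
  obtain ⟨i, j, hij, hfij⟩ := Fintype.exists_ne_map_eq_of_card_lt f (by simpa using hkn)
  rw [socialCost_eq]
  refine mul_le_mul_of_nonneg_left ?_ (by positivity)
  calc |x p.1 - x p.2| ≤ |x i - x j| := hmin (i, j) (by simpa using hij)
    _ ≤ |x i - y (f i)| + |y (f i) - x j| := abs_sub_le _ _ _
    _ = nearestDist y (x i) + nearestDist y (x j) := by
        rw [hf i, hf j, hfij, abs_sub_comm (y (f j))]
    _ = ∑ l ∈ {i, j}, nearestDist y (x l) := 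
        (Finset.sum_pair (f := fun l => nearestDist y (x l)) hij).symm
    _ ≤ ∑ l, nearestDist y (x l) := Finset.sum_le_sum_of_subset_of_nonneg
        (Finset.subset_univ _) fun l _ _ => nearestDist_nonneg y (x l)

variable {μ : Measure ℝ} [IsProbabilityMeasure μ]

theorem ae_injective_pi [NullSingletonClass μ] :
    ∀ᵐ x ∂(Measure.pi fun _ : Fin n => μ), Function.Injective x := by
  have key : ∀ i j : Fin n, i ≠ j → ∀ᵐ x ∂(Measure.pi fun _ : Fin n => μ), x i ≠ x j := by
    intro i j hij
    have hind := (iIndepFun_pi (μ := fun _ : Fin n => μ) (X := fun _ => id)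
      fun _ => aemeasurable_id).indepFun hij
    simp only [id] at hind
    have hmap := (indepFun_iff_map_prod_eq_prod_map_map (measurable_pi_apply i).aemeasurable
      (measurable_pi_apply j).aemeasurable).1 hind
    rw [(measurePreserving_eval (fun _ : Fin n => μ) i).map_eq,
      (measurePreserving_eval (fun _ : Fin n => μ) j).map_eq] at hmap
    have hcl : MeasurableSet {p : ℝ × ℝ | p.1 = p.2} :=
      measurableSet_eq_fun measurable_fst measurable_snd
    have h0 : (μ.prod μ) {p : ℝ × ℝ | p.1 = p.2} = 0 := by
      rw [Measure.measure_prod_null hcl]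
      refine ae_of_all _ fun t => ?_
      have : Prod.mk t ⁻¹' {p : ℝ × ℝ | p.1 = p.2} = {t} := by
        ext s; simp [eq_comm]
      simp only [this]
      exact measure_singleton t
    rw [← hmap, Measure.map_apply (by fun_prop) hcl] at h0
    exact measure_eq_zero_iff_ae_notMem.1 h0
  have hall : ∀ᵐ x ∂(Measure.pi fun _ : Fin n => μ), ∀ i j : Fin n, i ≠ j → x i ≠ x j :=
    ae_all_iff.2 fun i => ae_all_iff.2 fun j => by
      by_cases hij : i = j
      · exact ae_of_all _ fun x h => absurd hij h
      · filter_upwards [key i j hij] with x hx _ using hx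
  filter_upwards [hall] with x hx i j hxij
  by_contra hij
  exact hx i j hij hxij

theorem integrable_nearestDist_eval (hk : 0 < k) {a b : ℝ} (hI : μ.support ⊆ Icc a b)
    (y : Fin k → ℝ) (i : Fin n) :
    Integrable (fun x : Fin n → ℝ => nearestDist y (x i)) (Measure.pi fun _ => μ) :=
  (measurePreserving_eval (fun _ => μ) i).integrable_comp_of_integrable
    (integrable_nearestDist hk hI y)

theorem integrable_socialCost (hk : 0 < k) {a b : ℝ} (hI : μ.support ⊆ Icc a b)
    (y : Fin k → ℝ) :
    Integrable (fun x : Fin n → ℝ => socialCost x y) (Measure.pi fun _ => μ) := by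
  simp only [socialCost_eq]
  exact (integrable_finsetSum _ fun i _ => integrable_nearestDist_eval hk hI y i).const_mul _

theorem integral_socialCost (hk : 0 < k) (hn : 0 < n) {a b : ℝ} (hI : μ.support ⊆ Icc a b)
    (y : Fin k → ℝ) :
    ∫ x : Fin n → ℝ, socialCost x y ∂(Measure.pi fun _ => μ) = ∫ t, nearestDist y t ∂μ := by
  have hn0 : (n : ℝ) ≠ 0 := by exact_mod_cast hn.ne'
  simp only [socialCost_eq]
  rw [integral_const_mul, integral_finsetSum _ fun i _ => integrable_nearestDist_eval hk hI y i]
  simp only [integral_comp_eval (μ := fun _ : Fin n => μ) (f := nearestDist y)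
    (continuous_nearestDist hk y).aestronglyMeasurable, Finset.sum_const, Finset.card_univ,
    Fintype.card_fin, nsmul_eq_mul]
  field_simp

theorem integrable_optimalCost (hk : 0 < k) {a b : ℝ} (hI : μ.support ⊆ Icc a b) :
    Integrable (optimalCost k : (Fin n → ℝ) → ℝ) (Measure.pi fun _ => μ) := by
  refine (integrable_socialCost hk hI fun _ => 0).mono'
    (continuous_optimalCost hk).aestronglyMeasurable (ae_of_all _ fun x => ?_)
  rw [Real.norm_eq_abs, abs_of_nonneg (optimalCost_nonneg x)]
  exact optimalCost_le x _

theorem expectedOptimalCost_pos (hk : 0 < k) (hkn : k < n) [NullSingletonClass μ] {a b : ℝ}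
    (hI : μ.support ⊆ Icc a b) : 0 < expectedOptimalCost μ k n := by
  rw [expectedOptimalCost, integral_pos_iff_support_of_nonneg (fun x => optimalCost_nonneg x)
    (integrable_optimalCost hk hI)]
  have h : ∀ᵐ x ∂(Measure.pi fun _ : Fin n => μ),
      x ∈ Function.support (optimalCost k : (Fin n → ℝ) → ℝ) := by
    filter_upwards [ae_injective_pi] with x hx
    exact (optimalCost_pos hk hkn hx).ne'
  rw [prob_eq_one_of_ae_mem h]
  exact one_pos

theorem expectedOptimalCost_le (hk : 0 < k) (hn : 0 < n) {a b : ℝ} (hI : μ.support ⊆ Icc a b)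
    {ν : Measure ℝ} (hν : IsProjection k μ ν) :
    expectedOptimalCost μ k n ≤ (W1 μ ν).toReal := by
  obtain ⟨y, hy⟩ := exists_integral_nearestDist_le hk hI hν
  rw [← integral_socialCost hk hn hI] at hy
  exact (integral_mono (integrable_optimalCost hk hI) (integrable_socialCost hk hI y)
    fun x => optimalCost_le x y).trans hy

theorem W1_sub_le_expectedOptimalCost (hk : 0 < k) (hn : 0 < n) {a b : ℝ} (hab : a < b)
    (hI : μ.support ⊆ Icc a b) {ν : Measure ℝ} (hν : IsProjection k μ ν) :
    (W1 μ ν).toReal - 3 * (b - a) / Real.sqrt n ≤ expectedOptimalCost μ k n := by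
  have hn1 : (1 : ℝ) ≤ n := by exact_mod_cast hn
  have hn0 : (0 : ℝ) < n := by linarith
  have hr : 0 < Real.sqrt n := Real.sqrt_pos.2 hn0
  have hrr : Real.sqrt n * Real.sqrt n = n := Real.mul_self_sqrt hn0.le
  set r := Real.sqrt n
  have hr1 : 1 ≤ r := Real.one_le_sqrt.2 hn1
  set h := (b - a) / n with hdef
  have hh : 0 < h := div_pos (by linarith) hn0
  have hb : a + n * h = b := by rw [hdef]; field_simp; ring
  have hI' : μ.support ⊆ Icc a (a + n * h) := hb.symm ▸ hI
  set Z : ℕ → (Fin n → ℝ) → ℝ := fun l x =>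
    (empiricalCdf x (a + l * h) - cdf μ (a + l * h)) ^ 2
  set D : (Fin n → ℝ) → ℝ := fun x =>
    2 * h + h * ∑ l ∈ Finset.range n, (r * Z l x + 1 / r) / 2
  have habs : ∀ z : ℝ, |z| ≤ (r * z ^ 2 + 1 / r) / 2 := by
    intro z
    rw [← sq_abs]
    have h1 : r * |z| ^ 2 + 1 / r - 2 * |z| = (r * |z| - 1) ^ 2 / r := by field_simp; ring
    have h2 : 0 ≤ (r * |z| - 1) ^ 2 / r := by positivity
    linarith
  have hpath : ∀ᵐ x ∂(Measure.pi fun _ : Fin n => μ),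
      (W1 μ ν).toReal - D x ≤ optimalCost k x := by
    filter_upwards [ae_pi_forall (n := n) (ae_mem_of_support_subset hI')] with x hx
    refine le_ciInf fun y => ?_
    have h1 := W1_toReal_le_integral_nearestDist hk hI hν y
    have h2 := abs_mean_sub_integral_le hn (abs_nearestDist_sub_le hk y)
      (integrable_nearestDist hk hI y) hh hI' hx
    rw [← socialCost_eq] at h2
    have h3 : h * ∑ l ∈ Finset.range n, |empiricalCdf x (a + l * h) - cdf μ (a + l * h)| ≤
        h * ∑ l ∈ Finset.range n, (r * Z l x + 1 / r) / 2 :=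
      mul_le_mul_of_nonneg_left (Finset.sum_le_sum fun l _ => habs _) hh.le
    have h4 := (abs_le.1 h2).1
    simp only [D]
    linarith
  have hZi : ∀ l ∈ Finset.range n, Integrable (fun x => (r * Z l x + 1 / r) / 2)
      (Measure.pi fun _ : Fin n => μ) := fun l _ =>
    (((integrable_empiricalCdf_sub_sq _).const_mul r).add (integrable_const _)).div_const 2
  have hDi : Integrable D (Measure.pi fun _ : Fin n => μ) :=
    (integrable_const _).add ((integrable_finsetSum _ hZi).const_mul h)
  have hDint : ∫ x, D x ∂(Measure.pi fun _ : Fin n => μ) ≤ 3 * (b - a) / r := by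
    simp only [D]
    rw [integral_add (integrable_const _) ((integrable_finsetSum _ hZi).const_mul h),
      integral_const_mul h, integral_finsetSum _ hZi]
    simp only [integral_const, probReal_univ, smul_eq_mul, one_mul]
    have hterm : ∀ l ∈ Finset.range n,
        ∫ x, (r * Z l x + 1 / r) / 2 ∂(Measure.pi fun _ : Fin n => μ) ≤ 1 / r := by
      intro l _
      rw [integral_div, integral_add ((integrable_empiricalCdf_sub_sq _).const_mul r)
        (integrable_const _), integral_const_mul]
      simp only [integral_const, probReal_univ, smul_eq_mul, one_mul]
      have h1 := mul_le_mul_of_nonneg_left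
        (integral_empiricalCdf_sub_sq_le (μ := μ) hn (a + l * h)) hr.le
      have h2 : r * (1 / (4 * (n : ℝ))) = 1 / r / 4 := by rw [← hrr]; field_simp
      have h3 : 0 < 1 / r := by positivity
      linarith
    have hsum := Finset.sum_le_sum hterm
    simp only [Finset.sum_const, Finset.card_range, nsmul_eq_mul] at hsum
    have h1 : h * (n * (1 / r)) = (b - a) / r := by rw [hdef]; field_simp
    have h2 : h ≤ (b - a) / r := by
      refine div_le_div_of_nonneg_left (by linarith) hr ?_
      nlinarith
    have h3 := mul_le_mul_of_nonneg_left hsum hh.le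
    have h4 : 3 * (b - a) / r = 2 * ((b - a) / r) + (b - a) / r := by ring
    linarith
  have hmono := integral_mono_ae ((integrable_const _).sub hDi)
    (integrable_optimalCost (k := k) hk hI) hpath
  have hsub : ∫ x, ((W1 μ ν).toReal - D x) ∂(Measure.pi fun _ : Fin n => μ) =
      (W1 μ ν).toReal - ∫ x, D x ∂(Measure.pi fun _ : Fin n => μ) := by
    rw [integral_sub (integrable_const _) hDi]
    simp
  have hmono' : (W1 μ ν).toReal - ∫ x, D x ∂(Measure.pi fun _ : Fin n => μ) ≤
      expectedOptimalCost μ k n := hsub ▸ hmono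
  linarith

end OptimalCost

section MechanismCost

variable {n k : ℕ} {μ : Measure ℝ} [IsProbabilityMeasure μ]

theorem measurable_socialCost_percentileMechanism (hn : 0 < n) {v : Fin k → ℝ}
    (hv : ∀ j, v j ∈ Icc (0 : ℝ) 1) :
    Measurable fun x : Fin n → ℝ => socialCost x (percentileMechanism v x) := by
  simp only [socialCost]
  refine Measurable.const_mul (Finset.measurable_sum _ fun i _ => Measurable.iInf fun j => ?_) _
  have hm : Measurable fun x : Fin n → ℝ => percentileMechanism v x j :=
    measurable_samplePercentile hn (hv j)
  have hd := (measurable_pi_apply (X := fun _ : Fin n => ℝ) i).sub hm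
  exact continuous_abs.measurable.comp hd

theorem integrable_socialCost_percentileMechanism (hk : 0 < k) (hn : 0 < n) {v : Fin k → ℝ}
    (hv : ∀ j, v j ∈ Icc (0 : ℝ) 1) {a b : ℝ} (hI : μ.support ⊆ Icc a b) :
    Integrable (fun x : Fin n → ℝ => socialCost x (percentileMechanism v x))
      (Measure.pi fun _ => μ) := by
  refine Integrable.of_bound
    (measurable_socialCost_percentileMechanism hn hv).aestronglyMeasurable (b - a) ?_
  filter_upwards [ae_pi_forall (n := n) (ae_mem_of_support_subset hI)] with x hx
  rw [Real.norm_eq_abs, abs_of_nonneg (socialCost_nonneg _ _), socialCost_eq]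
  have hba : 0 ≤ b - a := by linarith [(hx ⟨0, hn⟩).1, (hx ⟨0, hn⟩).2]
  refine mean_le hba fun i => (nearestDist_le _ _ ⟨0, hk⟩).trans ?_
  obtain ⟨l, hl⟩ := samplePercentile_mem_range hn (hv ⟨0, hk⟩) x
  rw [percentileMechanism_apply, hl]
  exact abs_le.2 ⟨by linarith [(hx i).1, (hx l).2], by linarith [(hx i).2, (hx l).1]⟩

theorem expectedOptimalCost_le_expectedCost (hk : 0 < k) (hn : 0 < n) {v : Fin k → ℝ}
    (hv : ∀ j, v j ∈ Icc (0 : ℝ) 1) {a b : ℝ} (hI : μ.support ⊆ Icc a b) :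
    expectedOptimalCost μ k n ≤ expectedCost μ v n :=
  integral_mono (integrable_optimalCost hk hI)
    (integrable_socialCost_percentileMechanism hk hn hv hI) fun x => optimalCost_le x _

theorem socialCost_le_add (hk : 0 < k) {x : Fin n → ℝ} {y z : Fin k → ℝ} {e : ℝ} (he : 0 ≤ e)
    (h : ∀ i j, |x i - y j| ≤ |x i - z j| + e) : socialCost x y ≤ socialCost x z + e := by
  rw [socialCost_eq, socialCost_eq, ← sub_le_iff_le_add', ← mul_sub, ← Finset.sum_sub_distrib]
  refine mean_le he fun i => ?_
  linarith [nearestDist_le_add hk (h i)]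

theorem abs_socialCost_sub_le (hk : 0 < k) (x : Fin n → ℝ) (y z : Fin k → ℝ) :
    |socialCost x y - socialCost x z| ≤ ∑ j, |y j - z j| := by
  have key : ∀ y z : Fin k → ℝ, socialCost x y ≤ socialCost x z + ∑ j, |y j - z j| := by
    intro y z
    refine socialCost_le_add hk (Finset.sum_nonneg fun j _ => abs_nonneg _) fun i j => ?_
    have h1 := abs_sub_le (x i) (z j) (y j)
    have h2 := Finset.single_le_sum (f := fun j => |y j - z j|) (fun j _ => abs_nonneg _)
      (Finset.mem_univ j)
    rw [abs_sub_comm (z j)] at h1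
    linarith
  have h1 := key y z
  have h2 := key z y
  simp only [abs_sub_comm (z _)] at h2
  rw [abs_le]
  constructor <;> linarith

theorem tendsto_expectedCost (hk : 0 < k) {v q : Fin k → ℝ} (hv : ∀ j, v j ∈ Icc (0 : ℝ) 1)
    {a b : ℝ} (hI : μ.support ⊆ Icc a b) (hq : ∀ j, q j ∈ Icc a b ∧ IsQuantile μ (v j) (q j)) :
    Tendsto (fun n => expectedCost μ v n) atTop (𝓝 (∫ t, nearestDist q t ∂μ)) := by
  rw [tendsto_iff_norm_sub_tendsto_zero]
  have hlim : Tendsto (fun n : ℕ => ∑ j, ∫ x, |samplePercentile (v j) x - q j|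
      ∂(Measure.pi fun _ : Fin n => μ)) atTop (𝓝 0) := by
    have := tendsto_finsetSum Finset.univ fun j _ =>
      tendsto_integral_abs_samplePercentile_sub (hv j) hI (hq j).1 (hq j).2
    simpa using this
  refine squeeze_zero' (Eventually.of_forall fun n => norm_nonneg _) ?_ hlim
  filter_upwards [eventually_gt_atTop 0] with n hn
  have h1 := integrable_socialCost_percentileMechanism hk hn hv hI
  have h2 := integrable_socialCost (n := n) hk hI q
  have h3 : ∀ j ∈ Finset.univ, Integrable (fun x => |samplePercentile (v j) x - q j|)
      (Measure.pi fun _ : Fin n => μ) := fun j _ =>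
    integrable_abs_samplePercentile_sub hn (hv j) hI (hq j).1
  rw [expectedCost, ← integral_socialCost hk hn hI q, ← integral_sub h1 h2,
    ← integral_finsetSum _ h3]
  refine (norm_integral_le_integral_norm _).trans (integral_mono (h1.sub h2).norm
    (integrable_finsetSum _ h3) fun x => ?_)
  exact abs_socialCost_sub_le hk x _ q

theorem exists_expectedCost_le (hk : 0 < k) (hμ : IsRegularDistribution μ) {v q : Fin k → ℝ}
    (hv : ∀ j, v j ∈ Icc (0 : ℝ) 1) {a b : ℝ} (hI : μ.support ⊆ Icc a b)
    (hq : ∀ j, q j ∈ Icc a b ∧ IsQuantile μ (v j) (q j)) :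
    ∃ C : ℝ, 0 ≤ C ∧ ∀ n : ℕ, 0 < n →
      expectedCost μ v n ≤ ∫ t, nearestDist q t ∂μ + C / Real.sqrt n := by
  have hC : ∀ j, ∃ C : ℝ, 0 ≤ C ∧ (0 < v j → v j < 1 → ∀ n : ℕ, 0 < n →
      ∫ x, |samplePercentile (v j) x - q j| ∂(Measure.pi fun _ : Fin n => μ) ≤
        C / Real.sqrt n) := by
    intro j
    by_cases h : 0 < v j ∧ v j < 1
    · obtain ⟨C, hC, hle⟩ := exists_integral_abs_samplePercentile_sub_le hμ h.1 h.2 hI (hq j).1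
        (hq j).2
      exact ⟨C, hC, fun _ _ => hle⟩
    · exact ⟨0, le_rfl, fun h0 h1 => absurd ⟨h0, h1⟩ h⟩
  choose C hC0 hC using hC
  refine ⟨∑ j, C j, Finset.sum_nonneg fun j _ => hC0 j, fun n hn => ?_⟩
  set P := Measure.pi fun _ : Fin n => μ
  classical
  set e : Fin k → (Fin n → ℝ) → ℝ := fun j x =>
    if 0 < v j ∧ v j < 1 then |samplePercentile (v j) x - q j| else 0 with he
  have he0 : ∀ j x, 0 ≤ e j x := fun j x => by
    simp only [he]; split_ifs; exacts [abs_nonneg _, le_rfl]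
  have hei : ∀ j ∈ Finset.univ, Integrable (e j) P := fun j _ => by
    by_cases h : 0 < v j ∧ v j < 1
    · simp only [he, if_pos h]
      exact integrable_abs_samplePercentile_sub hn (hv j) hI (hq j).1
    · simp only [he, if_neg h]
      exact integrable_const _
  have hele : ∀ j, ∫ x, e j x ∂P ≤ C j / Real.sqrt n := fun j => by
    by_cases h : 0 < v j ∧ v j < 1
    · simp only [he, if_pos h]
      exact hC j h.1 h.2 n hn
    · simp only [he, if_neg h, integral_zero]
      exact div_nonneg (hC0 j) (Real.sqrt_nonneg _)
  have hcloser : ∀ j, ∀ᵐ x ∂P, ∀ i,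
      |x i - percentileMechanism v x j| ≤ |x i - q j| + e j x := by
    intro j
    by_cases h : 0 < v j ∧ v j < 1
    · refine ae_of_all _ fun x i => ?_
      simp only [he, if_pos h, percentileMechanism_apply]
      rw [abs_sub_comm (samplePercentile (v j) x)]
      exact abs_sub_le _ _ _
    · simp only [he, if_neg h, add_zero, percentileMechanism_apply]
      rcases (hv j).1.eq_or_lt with h0 | h0
      · rw [← h0]
        have hF : cdf μ (q j) = 0 := by rw [(hq j).2.cdf_eq, h0]
        filter_upwards [ae_pi_forall (n := n) (ae_lt_of_cdf_eq_zero hF)] with x hx i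
        obtain ⟨l, hl⟩ := samplePercentile_mem_range hn ⟨le_rfl, zero_le_one⟩ x
        have h1 := samplePercentile_zero_le hn x i
        rw [abs_of_nonneg (by linarith), abs_of_nonneg (by linarith [hx i])]
        linarith [hx l]
      · have hv1 : v j = 1 := le_antisymm (hv j).2 (not_lt.1 fun h1 => h ⟨h0, h1⟩)
        rw [hv1]
        have hF : cdf μ (q j) = 1 := by rw [(hq j).2.cdf_eq, hv1]
        filter_upwards [ae_pi_forall (n := n) (ae_le_of_cdf_eq_one hF)] with x hx i
        obtain ⟨l, hl⟩ := samplePercentile_mem_range hn ⟨zero_le_one, le_rfl⟩ x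
        have h1 := le_samplePercentile_one hn x i
        rw [abs_of_nonpos (by linarith), abs_of_nonpos (by linarith [hx i])]
        linarith [hx l]
  have hpath : ∀ᵐ x ∂P, socialCost x (percentileMechanism v x) ≤
      socialCost x q + ∑ j, e j x := by
    filter_upwards [ae_all_iff.2 hcloser] with x hx
    refine socialCost_le_add hk (Finset.sum_nonneg fun j _ => he0 j x) fun i j => ?_
    have h2 := Finset.single_le_sum (f := fun j => e j x) (fun j _ => he0 j x)
      (Finset.mem_univ j)
    linarith [hx j i]
  have hqi := integrable_socialCost (n := n) hk hI q
  have hmono := integral_mono_ae (integrable_socialCost_percentileMechanism hk hn hv hI)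
    (hqi.add (integrable_finsetSum _ hei)) hpath
  have hsplit : ∫ x, (socialCost x q + ∑ j, e j x) ∂P =
      ∫ t, nearestDist q t ∂μ + ∑ j, ∫ x, e j x ∂P := by
    rw [integral_add hqi (integrable_finsetSum _ hei), integral_finsetSum _ hei,
      integral_socialCost hk hn hI]
  have hfin : expectedCost μ v n ≤ ∫ t, nearestDist q t ∂μ + ∑ j, ∫ x, e j x ∂P :=
    hmono.trans (le_of_eq hsplit)
  rw [Finset.sum_div]
  linarith [Finset.sum_le_sum fun j (_ : j ∈ Finset.univ) => hele j]

end MechanismCost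

section Ratio

variable {k : ℕ} {μ : Measure ℝ} [IsProbabilityMeasure μ]

theorem tendsto_expectedOptimalCost (hk : 0 < k) {a b : ℝ} (hab : a < b)
    (hI : μ.support ⊆ Icc a b) {ν : Measure ℝ} (hν : IsProjection k μ ν) :
    Tendsto (fun n => expectedOptimalCost μ k n) atTop (𝓝 (W1 μ ν).toReal) := by
  have hlow : Tendsto (fun n : ℕ => (W1 μ ν).toReal - 3 * (b - a) / Real.sqrt n) atTop
      (𝓝 ((W1 μ ν).toReal - 0)) :=
    tendsto_const_nhds.sub
      ((Real.tendsto_sqrt_atTop.comp tendsto_natCast_atTop_atTop).const_div_atTop _)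
  rw [sub_zero] at hlow
  refine tendsto_of_tendsto_of_tendsto_of_le_of_le' hlow tendsto_const_nhds ?_ ?_
  · filter_upwards [eventually_gt_atTop 0] with n hn
    exact W1_sub_le_expectedOptimalCost hk hn hab hI hν
  · filter_upwards [eventually_gt_atTop 0] with n hn
    exact expectedOptimalCost_le hk hn hI hν

theorem one_le_bayesRatio (hk : 0 < k) [NullSingletonClass μ] {v : Fin k → ℝ}
    (hv : ∀ j, v j ∈ Icc (0 : ℝ) 1) {a b : ℝ} (hI : μ.support ⊆ Icc a b) {n : ℕ} (hn : k < n) :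
    1 ≤ bayesRatio μ v n := by
  rw [bayesRatio, one_le_div (expectedOptimalCost_pos hk hn hI)]
  exact expectedOptimalCost_le_expectedCost hk (by omega) hv hI

theorem exists_bayesRatio_le (hk : 0 < k) (hμ : IsRegularDistribution μ) {a b : ℝ} (hab : a < b)
    (hI : μ.support ⊆ Icc a b) {μt ν : Measure ℝ} [IsProbabilityMeasure μt]
    (hIt : μt.support ⊆ Icc a b) (hν : IsProjection k μ ν) {v : Fin k → ℝ}
    (hv : IsOptimalPercentileVector μt v) :
    ∃ C : ℝ, 0 < C ∧ ∀ n : ℕ, k < n → bayesRatio μ v n ≤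
      1 + ((WInf μ μt).toReal + 2 * (W1 μ μt).toReal) / (W1 μ ν).toReal + C / Real.sqrt n := by
  have := hμ.nullSingletonClass
  have hW := W1_toReal_pos hk hI hν
  obtain ⟨q, hq, hqle⟩ := exists_quantiles_integral_le hk hμ hI hIt hν hv
  obtain ⟨C, hC, hCle⟩ := exists_expectedCost_le hk hμ hv.mem_Icc hI hq
  have hM0 : 0 ≤ (WInf μ μt).toReal + 2 * (W1 μ μt).toReal :=
    add_nonneg ENNReal.toReal_nonneg (mul_nonneg zero_le_two ENNReal.toReal_nonneg)
  set W := (W1 μ ν).toReal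
  set M := (WInf μ μt).toReal + 2 * (W1 μ μt).toReal
  obtain ⟨K, hK⟩ := ((tendsto_expectedOptimalCost hk hab hI hν).inv₀ hW.ne').bddAbove_range
  have hK' : ∀ n, (expectedOptimalCost μ k n)⁻¹ ≤ K := fun n => hK (mem_range_self n)
  have hK0 : 0 < K := (inv_pos.2 (expectedOptimalCost_pos hk (Nat.lt_succ_self k) hI)).trans_le
    (hK' (k + 1))
  have hba : 0 < b - a := by linarith
  refine ⟨(W + M) / W * (3 * (b - a)) * K + C * K, by positivity, fun n hn => ?_⟩
  have hn0 : 0 < n := by omega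
  have hr : 0 < Real.sqrt n := Real.sqrt_pos.2 (by exact_mod_cast hn0)
  have he := expectedOptimalCost_pos hk hn hI
  have helow := W1_sub_le_expectedOptimalCost hk hn0 hab hI hν
  have hcost := hCle n hn0
  have hKn := hK' n
  set e := expectedOptimalCost μ k n
  have hdiff : W - e ≤ 3 * (b - a) / Real.sqrt n := by linarith
  have h1 : bayesRatio μ v n ≤ (W + M + C / Real.sqrt n) * e⁻¹ := by
    rw [bayesRatio, div_eq_mul_inv]
    exact mul_le_mul_of_nonneg_right (by linarith) (inv_pos.2 he).le
  have h2 : (W + M + C / Real.sqrt n) * e⁻¹ =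
      1 + M / W + ((W + M) / W * (W - e) + C / Real.sqrt n) * e⁻¹ := by
    field_simp
    ring
  have h3 : ((W + M) / W * (W - e) + C / Real.sqrt n) * e⁻¹ ≤
      ((W + M) / W * (3 * (b - a) / Real.sqrt n) + C / Real.sqrt n) * K := by
    have h4 : (W + M) / W * (W - e) + C / Real.sqrt n ≤
        (W + M) / W * (3 * (b - a) / Real.sqrt n) + C / Real.sqrt n :=
      add_le_add_left (mul_le_mul_of_nonneg_left hdiff (by positivity)) _
    exact (mul_le_mul_of_nonneg_right h4 (inv_pos.2 he).le).trans
      (mul_le_mul_of_nonneg_left hKn (by positivity))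
  have h5 : ((W + M) / W * (3 * (b - a)) * K + C * K) / Real.sqrt n =
      ((W + M) / W * (3 * (b - a) / Real.sqrt n) + C / Real.sqrt n) * K := by ring
  linarith

theorem lt_of_support_subset_Icc [NullSingletonClass μ] {a b : ℝ} (hI : μ.support ⊆ Icc a b) :
    a < b := by
  by_contra hab
  have h := measure_mono_null (fun x hx => ?_) (measure_singleton (μ := μ) a) (s := Icc a b)
  · have h1 := prob_eq_one_of_ae_mem (ae_mem_of_support_subset hI)
    rw [h] at h1
    exact zero_ne_one h1
  · exact le_antisymm (hx.2.trans (not_lt.1 hab)) hx.1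

end Ratio

end PercentileFLP

theorem theorem10 (k : ℕ) (hk : 0 < k) (a b : ℝ)
    (μ μt : Measure ℝ) [IsProbabilityMeasure μ] [IsProbabilityMeasure μt]
    (hμ : PercentileFLP.IsRegularDistribution μ)
    (hμI : μ.support ⊆ Icc a b) (hμtI : μt.support ⊆ Icc a b)
    (ν : Measure ℝ) (hν : PercentileFLP.IsProjection k μ ν)
    (v vt : Fin k → ℝ) (hv : PercentileFLP.IsOptimalPercentileVector μ v)
    (hvt : PercentileFLP.IsOptimalPercentileVector μt vt) :
    0 < (PercentileFLP.W1 μ ν).toReal ∧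
    (∀ n : ℕ, k < n → 0 < PercentileFLP.expectedOptimalCost μ k n) ∧
    (∃ L : ℝ,
      Tendsto (fun n : ℕ =>
        |PercentileFLP.expectedCost μ vt n / PercentileFLP.expectedOptimalCost μ k n - 1|)
        atTop (𝓝 L) ∧
      L ≤ ((PercentileFLP.WInf μ μt).toReal + 2 * (PercentileFLP.W1 μ μt).toReal) /
        (PercentileFLP.W1 μ ν).toReal) ∧
    ((PercentileFLP.WInf μ μt).toReal + 2 * (PercentileFLP.W1 μ μt).toReal) /
        (PercentileFLP.W1 μ ν).toReal ≤
      3 * ((PercentileFLP.WInf μ μt).toReal / (PercentileFLP.W1 μ ν).toReal) ∧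
    (∃ C : ℝ, 0 < C ∧ ∀ n : ℕ, k < n →
      |PercentileFLP.bayesRatio μ v n - PercentileFLP.bayesRatio μ vt n| ≤
        3 * ((PercentileFLP.WInf μ μt).toReal / (PercentileFLP.W1 μ ν).toReal) +
          C / Real.sqrt n) := by

  have := hμ.nullSingletonClass
  have hab := PercentileFLP.lt_of_support_subset_Icc hμI
  have hW := PercentileFLP.W1_toReal_pos hk hμI hν
  have hle : (PercentileFLP.W1 μ μt).toReal ≤ (PercentileFLP.WInf μ μt).toReal :=
    ENNReal.toReal_mono (PercentileFLP.WInf_ne_top hμI hμtI) (PercentileFLP.W1_le_WInf μ μt)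
  have hM : ((PercentileFLP.WInf μ μt).toReal + 2 * (PercentileFLP.W1 μ μt).toReal) /
      (PercentileFLP.W1 μ ν).toReal ≤
        3 * ((PercentileFLP.WInf μ μt).toReal / (PercentileFLP.W1 μ ν).toReal) := by
    rw [← mul_div_assoc]
    exact div_le_div_of_nonneg_right (by linarith) hW.le
  refine ⟨hW, fun n hn => PercentileFLP.expectedOptimalCost_pos hk hn hμI, ?_, hM, ?_⟩
  · obtain ⟨q, hq, hqle⟩ := PercentileFLP.exists_quantiles_integral_le hk hμ hμI hμtI hν hvt
    have hge := PercentileFLP.W1_toReal_le_integral_nearestDist hk hμI hν q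
    refine ⟨_, (((PercentileFLP.tendsto_expectedCost hk hvt.mem_Icc hμI hq).div
      (PercentileFLP.tendsto_expectedOptimalCost hk hab hμI hν) hW.ne').sub_const 1).abs, ?_⟩
    rw [div_sub_one hW.ne', abs_of_nonneg (div_nonneg (by linarith) hW.le)]
    exact div_le_div_of_nonneg_right (by linarith) hW.le
  · obtain ⟨C, hC, hCle⟩ := PercentileFLP.exists_bayesRatio_le hk hμ hab hμI hμI hν hv
    obtain ⟨Ct, hCt, hCtle⟩ := PercentileFLP.exists_bayesRatio_le hk hμ hab hμI hμtI hν hvt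
    have hself : PercentileFLP.W1 μ μ = 0 :=
      le_antisymm ((PercentileFLP.W1_le_WInf μ μ).trans (PercentileFLP.WInf_self μ).le) zero_le
    simp only [PercentileFLP.WInf_self, hself, ENNReal.toReal_zero, mul_zero, add_zero,
      zero_div] at hCle
    refine ⟨C + Ct, by positivity, fun n hn => ?_⟩
    have h1 := hCle n hn
    have h2 := hCtle n hn
    have h3 := PercentileFLP.one_le_bayesRatio hk hv.mem_Icc hμI hn
    have h4 := PercentileFLP.one_le_bayesRatio hk hvt.mem_Icc hμI hn
    have h5 : 0 ≤ (PercentileFLP.WInf μ μt).toReal / (PercentileFLP.W1 μ ν).toReal :=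
      div_nonneg ENNReal.toReal_nonneg ENNReal.toReal_nonneg
    have h6 : 0 ≤ C / Real.sqrt n := by positivity
    have h7 : 0 ≤ Ct / Real.sqrt n := by positivity
    rw [add_div, abs_le]
    constructor <;> linarith
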